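/- Let $K$ be a commutative ring (for instance $K=\mathbb C$ or $K=\mathbb C[d,d^{-1}]$), let $d\in K$ be invertible, and let $n\ge 0$. Let $\mathcal G_n$ be the set of isotopy classes (relative to the boundary) of planar graphs $G$ embedded in a rectangle $R$ that meet $\partial R$ in exactly $n$ endpoints of edges at the top and $n$ at the bottom. Loops, multiple edges, isolated vertices, several components, and closed-curve components without vertices are allowed; the vertices of $G$ are those in the interior of $R$, and an edge is inner if it does not end on $\partial R$. Let $\mathcal F_n$ be the free $K$-module on $\mathcal G_n$, an algebra under vertical stacking. For $Q\in K$ the chromatic algebra $\mathcal C_n^Q$ is the quotient of $\mathcal F_n$ by the two-sided ideal generated by the relations 1. $G=G/e-G\smallsetminus e$ if $e$ is an inner edge of $G$ that is not a loop; 2. $G=(Q-1)\,G\smallsetminus e$ if $e$ is an inner edge of $G$ that is a loop, or a simple closed curve not containing a vertex; 3. $G=0$ if $G$ has a vertex of valence $1$. Let $TL^d_m$ be the Temperley–Lieb algebra: the free $K$-module on the isotopy classes of one-dimensional submanifolds of $R$ with $m$ endpoints at the top and $m$ at the bottom, with vertical stacking as the product, modulo the relation that a simple closed curve may be removed at the expense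 of a factor $d$. For a graph $G\in\mathcal G_n$ define $\phi(G)\in TL^d_{2n}$ as follows. Replace every edge of $G$ by two parallel strands carrying the linear combination $P_2=(\text{two parallel strands})-\frac1d(\text{turnback})$, and resolve every vertex by joining neighbouring strands of cyclically consecutive edges (so that, for every set $S$ of edges on which the parallel strands are chosen, one obtains the boundary of a regular neighbourhood of the graph with the vertices of $G$ and the edges $S$, the other edges contributing turnbacks; an isolated vertex gives a circle). Multiply the result by $\prod_V d^{(r(V)-2)/2}$, where $V$ runs over the vertices of $G$ and $r(V)$ is the valence; the total exponent $\sum_V (r(V)-2)/2$ is an integer. Then $\phi$ induces a well-defined homomorphism of algebras $\mathcal C_n^{Q}\to TL^d_{2n}$ for $Q=d^2$: there is exactly one $K$-linear multiplicative map $\Phi:\mathcal C^{d^2}_n\to TL^d_{2n}$ with $\Phi([G])=\phi(G)$ for all $G\in\mathcal G_n$. (It is not required to preserve the units: the unit of $\mathcal C_n^{d^2}$ is sent to $P_2^{\otimes n}$.) -/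

import Mathlib

namespace PlanarPictures

/-! ### Pictures in a rectangle

A planar graph in the rectangle, in general position with respect to the height function, is read
from the top to the bottom as a word of elementary slices. Each slice contains one critical level:
a local maximum, a local minimum, or a vertex; all other strands run vertically. -/

/-- The elementary pieces. `cap` is a local maximum (going down, two new strands appear),
`cup` is a local minimum (two adjacent strands are joined), and `vertex p q` is a vertex with
`p` legs going up and `q` legs going down, hence of valence `p + q`. -/
inductive Piece : Type
  | cap : Piece
  | cup : Piece
  | vertex (p q : ℕ) : Piece

/-- Number of strands entering a piece from above. -/
def Piece.ins : Piece → ℕ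
  | .cap => 0
  | .cup => 2
  | .vertex p _ => p

/-- Number of strands leaving a piece below. -/
def Piece.outs : Piece → ℕ
  | .cap => 2
  | .cup => 0
  | .vertex _ q => q

/-- A piece that is not a vertex. -/
def Piece.IsArc : Piece → Prop
  | .cap => True
  | .cup => True
  | .vertex _ _ => False

/-- A slice: an elementary piece with `left` vertical strands to its left. The number of vertical
strands to its right is determined by the total number of strands. -/
structure Slice : Type where
  left : ℕ
  piece : Piece

/-- `Runs m w n`: the word `w`, read from the top to the bottom, starts with `m` strands, makes
sense at every slice, and ends with `n` strands. -/
def Runs : ℕ → List Slice → ℕ → Prop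
  | m, [], n => m = n
  | m, s :: w, n =>
      s.left + s.piece.ins ≤ m ∧ Runs (m - s.piece.ins + s.piece.outs) w n

theorem Runs.append {w₁ w₂ : List Slice} {k l m : ℕ} (h₁ : Runs k w₁ l) (h₂ : Runs l w₂ m) :
    Runs k (w₁ ++ w₂) m := by
  induction w₁ generalizing k with
  | nil => cases h₁; exact h₂
  | cons s w ih => exact ⟨h₁.1, ih h₁.2⟩

/-- Translate a word to the right by `a` strands. -/
def shift (a : ℕ) (w : List Slice) : List Slice :=
  w.map fun s => ⟨a + s.left, s.piece⟩

/-- Drawings of graphs in the rectangle with `n` endpoints at the top and `n` at the bottom.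
Edges may end on the boundary, graphs may be disconnected, may have loops, multiple edges and
isolated vertices, and may have components that are closed curves without vertices. -/
def Drawing (n : ℕ) : Type := {w : List Slice // Runs n w n}

/-- The word of a drawing. -/
def Drawing.word {n : ℕ} (D : Drawing n) : List Slice := D.1

/-- Drawings are multiplied by vertical stacking: `x * y` is `x` on top of `y`. -/
instance (n : ℕ) : Monoid (Drawing n) where
  mul x y := ⟨x.1 ++ y.1, x.2.append y.2⟩
  one := ⟨[], rfl⟩
  mul_assoc _ _ _ := Subtype.ext (List.append_assoc _ _ _)
  one_mul _ := Subtype.ext (List.nil_append _)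
  mul_one _ := Subtype.ext (List.append_nil _)

/-- The events in a generic planar isotopy: two pieces that lie side by side exchange their
heights; a local maximum and an adjacent local minimum cancel; the rightmost or the leftmost
descending leg of a vertex turns upwards. -/
inductive Move : List Slice → List Slice → Prop
  | slide (a c : ℕ) (g h : Piece) :
      Move [⟨a, g⟩, ⟨a + g.outs + c, h⟩] [⟨a + g.ins + c, h⟩, ⟨a, g⟩]
  | straighten_left (a : ℕ) : Move [⟨a, .cap⟩, ⟨a + 1, .cup⟩] []
  | straighten_right (a : ℕ) : Move [⟨a + 1, .cap⟩, ⟨a, .cup⟩] []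
  | bend_right (a p q : ℕ) :
      Move [⟨a, .vertex p (q + 1)⟩, ⟨a + q, .cup⟩] [⟨a, .vertex (p + 1) q⟩]
  | bend_left (a p q : ℕ) :
      Move [⟨a + 1, .vertex p (q + 1)⟩, ⟨a, .cup⟩] [⟨a, .vertex (p + 1) q⟩]

/-- Two drawings that differ by one event, and agree above and below it. -/
def Step {n : ℕ} (x y : Drawing n) : Prop :=
  ∃ u s t v : List Slice, Move s t ∧ x.word = u ++ s ++ v ∧ y.word = u ++ t ++ v

/-- Planar isotopy of drawings, relative to the boundary of the rectangle. -/
def isotopy (n : ℕ) : Con (Drawing n) := conGen Step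

/-- Isotopy classes of planar graphs in the rectangle with `n` endpoints at the top and `n` at
the bottom, a monoid under vertical stacking. -/
abbrev PlanarGraph (n : ℕ) : Type := (isotopy n).Quotient

/-- Drawings without vertices, i.e. drawings of one-dimensional submanifolds. -/
def curves (n : ℕ) : Submonoid (Drawing n) where
  carrier := {D | ∀ s ∈ D.word, s.piece.IsArc}
  mul_mem' hx hy := fun s hs => (List.mem_append.1 hs).elim (hx s) (hy s)
  one_mem' := fun _ hs => absurd hs List.not_mem_nil

/-- Isotopy classes of one-dimensional submanifolds of the rectangle with `n` endpoints at the top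
and `n` at the bottom, a monoid under vertical stacking. -/
abbrev PlanarCurve (n : ℕ) : Type :=
  (Con.comap (curves n).subtype (curves n).subtype.map_mul (isotopy n)).Quotient

noncomputable section

/-! ### The chromatic algebra -/

/-- The free algebra on isotopy classes of planar graphs. -/
abbrev GraphAlgebra (K : Type*) [CommRing K] (n : ℕ) : Type _ := MonoidAlgebra K (PlanarGraph n)

/-- The generator of the free algebra given by a drawing. -/
def graph (K : Type*) [CommRing K] {n : ℕ} (D : Drawing n) : GraphAlgebra K n :=
  MonoidAlgebra.of K (PlanarGraph n) (D : PlanarGraph n)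

/-- The local relations of the chromatic algebra. In each of them the pictures agree outside of a
disk, which is moved into standard position by an isotopy. -/
inductive ChromaticRel (K : Type*) [CommRing K] (Q : K) (n : ℕ) :
    GraphAlgebra K n → GraphAlgebra K n → Prop
  /-- An inner edge `e` with two different endpoints: `G = G/e - G∖e`. -/
  | contraction_deletion (u v : List Slice) (a p q : ℕ) (G G₁ G₂ : Drawing n)
      (hG : G.word = u ++ [⟨a, .vertex p 1⟩, ⟨a, .vertex 1 q⟩] ++ v)
      (hG₁ : G₁.word = u ++ [⟨a, .vertex p q⟩] ++ v)
      (hG₂ : G₂.word = u ++ [⟨a, .vertex p 0⟩, ⟨a, .vertex 0 q⟩] ++ v) :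
      ChromaticRel K Q n (graph K G) (graph K G₁ - graph K G₂)
  /-- A loop `e` at a vertex: `G = (Q - 1) G∖e`. Here `X` is the part of `G` inside the loop, which
  is attached to the vertex by `k` legs. -/
  | loop (u X v : List Slice) (a p k : ℕ) (hX : Runs k X 0) (G G₁ : Drawing n)
      (hG : G.word = u ++ [⟨a, .vertex p (k + 2)⟩] ++ shift (a + 1) X ++ [⟨a, .cup⟩] ++ v)
      (hG₁ : G₁.word = u ++ [⟨a, .vertex p k⟩] ++ shift a X ++ v) :
      ChromaticRel K Q n (graph K G) ((Q - 1) • graph K G₁)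
  /-- A simple closed curve `e` without vertices, with the part `X` of `G` inside of it:
  `G = (Q - 1) G∖e`. -/
  | circle (u X v : List Slice) (a : ℕ) (hX : Runs 0 X 0) (G G₁ : Drawing n)
      (hG : G.word = u ++ [⟨a, .cap⟩] ++ shift (a + 1) X ++ [⟨a, .cup⟩] ++ v)
      (hG₁ : G₁.word = u ++ shift a X ++ v) :
      ChromaticRel K Q n (graph K G) ((Q - 1) • graph K G₁)
  /-- A graph with a vertex of valence one vanishes. -/
  | univalent (u v : List Slice) (a : ℕ) (G : Drawing n)
      (hG : G.word = u ++ [⟨a, .vertex 0 1⟩] ++ v) :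
      ChromaticRel K Q n (graph K G) 0

/-- The chromatic algebra: the quotient of the free algebra on isotopy classes of planar graphs by
the two-sided ideal generated by the local relations. -/
abbrev ChromaticAlgebra (K : Type*) [CommRing K] (Q : K) (n : ℕ) : Type _ :=
  RingQuot (ChromaticRel K Q n)

/-- The class of a graph in the chromatic algebra. -/
def chromaticClass {K : Type*} [CommRing K] (Q : K) {n : ℕ} (G : Drawing n) :
    ChromaticAlgebra K Q n :=
  RingQuot.mkAlgHom K (ChromaticRel K Q n) (graph K G)

/-! ### The Temperley-Lieb algebra -/

/-- The free algebra on isotopy classes of one-dimensional submanifolds of the rectangle. -/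
abbrev CurveAlgebra (K : Type*) [CommRing K] (n : ℕ) : Type _ := MonoidAlgebra K (PlanarCurve n)

/-- The generator given by a drawing without vertices. -/
def curve (K : Type*) [CommRing K] {n : ℕ} (D : curves n) : CurveAlgebra K n :=
  MonoidAlgebra.of K (PlanarCurve n) (D : PlanarCurve n)

/-- A simple closed curve, possibly with other closed curves `X` inside of it, is removed at the
expense of a factor `d`. -/
inductive LoopRel (K : Type*) [CommRing K] (d : K) (n : ℕ) :
    CurveAlgebra K n → CurveAlgebra K n → Prop
  | circle (u X v : List Slice) (a : ℕ) (hX : Runs 0 X 0) (D D₁ : curves n)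
      (hD : D.1.word = u ++ [⟨a, .cap⟩] ++ shift (a + 1) X ++ [⟨a, .cup⟩] ++ v)
      (hD₁ : D₁.1.word = u ++ shift a X ++ v) :
      LoopRel K d n (curve K D) (d • curve K D₁)

/-- The planar Temperley-Lieb algebra on `n` strands with loop value `d`. -/
abbrev TemperleyLieb (K : Type*) [CommRing K] (d : K) (n : ℕ) : Type _ :=
  RingQuot (LoopRel K d n)

/-- The class of a one-dimensional submanifold in the Temperley-Lieb algebra. -/
def curveClass {K : Type*} [CommRing K] (d : K) {n : ℕ} (D : curves n) : TemperleyLieb K d n :=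
  RingQuot.mkAlgHom K (LoopRel K d n) (curve K D)

/-! ### The edges of a drawing -/

/-- The number of strands between slice `i - 1` and slice `i`, starting with `m` strands. -/
def width : ℕ → List Slice → ℕ → ℕ
  | m, _, 0 => m
  | m, [], _ + 1 => m
  | m, s :: w, i + 1 => width (m - s.piece.ins + s.piece.outs) w i

/-- The points `(i, j)` of a drawing: the `j`-th strand at level `i`. -/
def Drawing.Point {n : ℕ} (G : Drawing n) (x : ℕ × ℕ) : Prop :=
  x.1 ≤ G.word.length ∧ x.2 < width n G.word x.1

/-- Points that follow each other along an edge: on a strand that passes to the left or to the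
right of a piece, or on the two sides of a local maximum or minimum. -/
inductive Follows (w : List Slice) : ℕ × ℕ → ℕ × ℕ → Prop
  | pass_left (i j : ℕ) (s : Slice) (hs : w[i]? = some s) (hj : j < s.left) :
      Follows w (i, j) (i + 1, j)
  | pass_right (i j : ℕ) (s : Slice) (hs : w[i]? = some s) :
      Follows w (i, s.left + s.piece.ins + j) (i + 1, s.left + s.piece.outs + j)
  | cap (i a : ℕ) (hs : w[i]? = some ⟨a, .cap⟩) : Follows w (i + 1, a) (i + 1, a + 1)
  | cup (i a : ℕ) (hs : w[i]? = some ⟨a, .cup⟩) : Follows w (i, a) (i, a + 1)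

/-- Two points lie on the same edge. -/
def SameEdge (w : List Slice) : ℕ × ℕ → ℕ × ℕ → Prop := Relation.EqvGen (Follows w)

/-- `E` consists of exactly one point on every edge of `G`. -/
def Drawing.EdgePoints {n : ℕ} (G : Drawing n) (E : Finset (ℕ × ℕ)) : Prop :=
  (∀ x ∈ E, G.Point x) ∧ ∀ x, G.Point x → ∃! y, y ∈ E ∧ SameEdge G.word x y

/-! ### The map from graphs to the Temperley-Lieb algebra -/

/-- `r - 2` for a vertex of valence `r`, and `0` for a local maximum or minimum. -/
def Piece.excess : Piece → ℤ
  | .cap => 0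
  | .cup => 0
  | .vertex p q => (p : ℤ) + q - 2

/-- The sum of `r(V) - 2` over all vertices `V`. -/
def excess (w : List Slice) : ℤ := (w.map fun s => s.piece.excess).sum

/-- The product of the factors `d ^ ((r(V) - 2) / 2)` over all vertices `V` of `G`. The total
exponent is an integer, see `Drawing.even_excess` and `Drawing.weight_eq_prod`. -/
def Drawing.weight {K : Type*} [CommRing K] (d : Kˣ) {n : ℕ} (G : Drawing n) : Kˣ :=
  d ^ (excess G.word / 2)

theorem Runs.even_excess {w : List Slice} {m n : ℕ} (h : Runs m w n) :
    Even (excess w + m + n) := by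
  induction w generalizing m with
  | nil => cases h; simp [excess]
  | cons s w ih =>
    obtain ⟨a, g⟩ := s
    have h2 := ih h.2
    have h1 := h.1
    rw [Int.even_iff] at h2 ⊢
    cases g <;>
      simp only [excess, List.map_cons, List.sum_cons, Piece.excess, Piece.ins, Piece.outs]
        at h1 h2 ⊢ <;> omega

theorem Drawing.even_excess {n : ℕ} (G : Drawing n) : Even (excess G.word) := by
  have h := G.2.even_excess
  rw [Int.even_iff] at h ⊢
  simp only [Drawing.word]
  omega

theorem Drawing.weight_eq_prod {K : Type*} [CommRing K] {d s : Kˣ} (hs : s ^ 2 = d) {n : ℕ}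
    (G : Drawing n) : G.weight d = (G.word.map fun x => s ^ x.piece.excess).prod := by
  have h : ∀ w : List Slice, (w.map fun x => s ^ x.piece.excess).prod = s ^ excess w := by
    intro w
    induction w with
    | nil => simp [excess]
    | cons x w ih =>
      rw [List.map_cons, List.prod_cons, ih, ← zpow_add]
      simp [excess]
  rw [h, Drawing.weight, ← hs, ← zpow_natCast, ← zpow_mul]
  congr 1
  exact Int.mul_ediv_cancel' G.even_excess.two_dvd

/-- The boundary of a regular neighbourhood of a piece: every leg is doubled; the strands at a
vertex are obtained by joining the neighbouring strands of consecutive legs. -/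
def double : Slice → List Slice
  | ⟨a, .cap⟩ => [⟨2 * a, .cap⟩, ⟨2 * a + 1, .cap⟩]
  | ⟨a, .cup⟩ => [⟨2 * a + 1, .cup⟩, ⟨2 * a, .cup⟩]
  | ⟨a, .vertex p q⟩ =>
      (match p with
        | 0 => [⟨2 * a, .cap⟩]
        | p' + 1 => List.replicate p' ⟨2 * a + 1, .cup⟩) ++
      (match q with
        | 0 => [⟨2 * a, .cup⟩]
        | q' + 1 => List.replicate q' ⟨2 * a + 1, .cap⟩)

/-- Formal linear combinations of words of slices. -/
abbrev WordAlgebra (K : Type*) [CommRing K] : Type _ := MonoidAlgebra K (FreeMonoid Slice)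

/-- A word as an element of the word algebra. -/
def ofWord (K : Type*) [CommRing K] (w : List Slice) : WordAlgebra K :=
  MonoidAlgebra.of K (FreeMonoid Slice) (FreeMonoid.ofList w)

/-- The linear combination `P₂ = (two parallel strands) - (1/d) (turnback)` placed on the doubled
`j`-th strand. -/
def projector {K : Type*} [CommRing K] (d : Kˣ) (j : ℕ) : WordAlgebra K :=
  1 - ((d⁻¹ : Kˣ) : K) • ofWord K [⟨2 * j, .cup⟩, ⟨2 * j, .cap⟩]

/-- `P₂` on the doubles of those among the `m` strands at level `i` that carry a point of `E`. -/
def projectors {K : Type*} [CommRing K] (d : Kˣ) (E : Finset (ℕ × ℕ)) (i m : ℕ) : WordAlgebra K :=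
  ((List.range m).map fun j => if (i, j) ∈ E then projector d j else 1).prod

/-- Double all strands and vertices of a word that starts at level `i` with `m` strands, and insert
`P₂` at the points of `E`. -/
def cable {K : Type*} [CommRing K] (d : Kˣ) (E : Finset (ℕ × ℕ)) :
    ℕ → ℕ → List Slice → WordAlgebra K
  | i, m, [] => projectors d E i m
  | i, m, s :: w =>
      projectors d E i m * ofWord K (double s) *
        cable d E (i + 1) (m - s.piece.ins + s.piece.outs) w

theorem Runs.replicate_cup (a b k : ℕ) :
    Runs (a + 2 * k + 1 + b) (List.replicate k ⟨a, .cup⟩) (a + 1 + b) := by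
  induction k with
  | zero => exact rfl
  | succ k ih =>
    refine ⟨by simp only [Piece.ins]; omega, ?_⟩
    convert ih using 1
    simp only [Piece.ins, Piece.outs]; omega

theorem Runs.replicate_cap (a b k : ℕ) :
    Runs (a + b) (List.replicate k ⟨a, .cap⟩) (a + 2 * k + b) := by
  induction k generalizing b with
  | zero => exact rfl
  | succ k ih =>
    refine ⟨by simp only [Piece.ins]; omega, ?_⟩
    convert ih (b + 2) using 1
    · simp only [Piece.ins, Piece.outs]; omega
    · omega

theorem runs_double {m : ℕ} (s : Slice) (h : s.left + s.piece.ins ≤ m) :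
    Runs (2 * m) (double s) (2 * (m - s.piece.ins + s.piece.outs)) := by
  obtain ⟨a, g⟩ := s
  cases g with
  | cap => simp only [double, Runs, Piece.ins, Piece.outs] at h ⊢; omega
  | cup => simp only [double, Runs, Piece.ins, Piece.outs] at h ⊢; omega
  | vertex p q =>
    simp only [Piece.ins, Piece.outs] at h ⊢
    refine Runs.append (l := 2 * (m - p + 1)) ?_ ?_
    · cases p with
      | zero => simp only [Runs, Piece.ins, Piece.outs]; omega
      | succ p =>
        have := Runs.replicate_cup (2 * a + 1) (2 * m - (2 * a + 1 + 2 * p + 1)) p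
        convert this using 1 <;> omega
    · cases q with
      | zero => simp only [Runs, Piece.ins, Piece.outs]; omega
      | succ q =>
        have := Runs.replicate_cap (2 * a + 1) (2 * (m - p + 1) - (2 * a + 1)) q
        convert this using 1 <;> omega

theorem isArc_double (s x : Slice) (hx : x ∈ double s) : x.piece.IsArc := by
  obtain ⟨a, g⟩ := s
  rcases g with _ | _ | ⟨_ | p, _ | q⟩ <;>
    simp only [double, List.mem_append, List.mem_cons, List.mem_replicate, List.not_mem_nil,
      or_false] at hx <;>
    rcases hx with hx | hx <;> simp_all [Piece.IsArc]

/-- The words that are drawings without vertices with `m` endpoints at the top and `n` at the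
bottom. -/
def curveWords (K : Type*) [CommRing K] (m n : ℕ) : Set (WordAlgebra K) :=
  {f | ∃ w : List Slice, Runs m w n ∧ (∀ s ∈ w, s.piece.IsArc) ∧ f = ofWord K w}

theorem mul_mem_span_curveWords {K : Type*} [CommRing K] {k l m : ℕ} {f g : WordAlgebra K}
    (hf : f ∈ Submodule.span K (curveWords K k l))
    (hg : g ∈ Submodule.span K (curveWords K l m)) :
    f * g ∈ Submodule.span K (curveWords K k m) := by
  have h := Submodule.mul_mem_mul hf hg
  rw [Submodule.span_mul_span] at h
  refine Submodule.span_mono ?_ h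
  rintro _ ⟨_, ⟨w₁, h₁, h₁', rfl⟩, _, ⟨w₂, h₂, h₂', rfl⟩, rfl⟩
  refine ⟨w₁ ++ w₂, h₁.append h₂, fun s hs => (List.mem_append.1 hs).elim (h₁' s) (h₂' s), ?_⟩
  simp only [ofWord, FreeMonoid.ofList_append, map_mul]

theorem one_mem_span_curveWords {K : Type*} [CommRing K] (m : ℕ) :
    (1 : WordAlgebra K) ∈ Submodule.span K (curveWords K m m) :=
  Submodule.subset_span ⟨[], rfl, by simp, (map_one (MonoidAlgebra.of K (FreeMonoid Slice))).symm⟩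

theorem projectors_mem_span {K : Type*} [CommRing K] (d : Kˣ) (E : Finset (ℕ × ℕ)) (i m : ℕ) :
    projectors d E i m ∈ Submodule.span K (curveWords K (2 * m) (2 * m)) := by
  have key : ∀ L : List ℕ, (∀ j ∈ L, j < m) →
      (L.map fun j => if (i, j) ∈ E then projector d j else 1).prod ∈
        Submodule.span K (curveWords K (2 * m) (2 * m)) := by
    intro L
    induction L with
    | nil => intro _; simpa using one_mem_span_curveWords (2 * m)
    | cons j L ih =>
      intro hL
      rw [List.map_cons, List.prod_cons]
      refine mul_mem_span_curveWords ?_ (ih fun x hx => hL x (List.mem_cons_of_mem _ hx))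
      have hj := hL j List.mem_cons_self
      split_ifs
      · refine Submodule.sub_mem _ (one_mem_span_curveWords _) (Submodule.smul_mem _ _ ?_)
        refine Submodule.subset_span ⟨_, ?_, ?_, rfl⟩
        · simp only [Runs, Piece.ins, Piece.outs]; omega
        · simp [Piece.IsArc]
      · exact one_mem_span_curveWords _
  exact key _ fun j hj => List.mem_range.1 hj

/-- All words in the doubling of a drawing are drawings without vertices. -/
theorem cable_mem_span {K : Type*} [CommRing K] (d : Kˣ) (E : Finset (ℕ × ℕ)) {w : List Slice}
    {m n : ℕ} (h : Runs m w n) (i : ℕ) :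
    cable d E i m w ∈ Submodule.span K (curveWords K (2 * m) (2 * n)) := by
  induction w generalizing i m with
  | nil => cases h; exact projectors_mem_span d E i _
  | cons s w ih =>
    refine mul_mem_span_curveWords (mul_mem_span_curveWords (projectors_mem_span d E i m) ?_)
      (ih h.2 (i + 1))
    exact Submodule.subset_span ⟨_, runs_double s h.1, isArc_double s, rfl⟩

open Classical in
/-- The linear map that sends a word that is a drawing without vertices to its class in the
Temperley-Lieb algebra. It is only applied to linear combinations of such words, see
`cable_mem_span`; all other words are dropped. -/
def toTL {K : Type*} [CommRing K] (d : K) (n : ℕ) (f : WordAlgebra K) : TemperleyLieb K d n :=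
  f.coeff.sum fun w c =>
    if h : Runs n w.toList n ∧ ∀ s ∈ w.toList, s.piece.IsArc then
      c • curveClass d (⟨⟨w.toList, h.1⟩, h.2⟩ : curves n)
    else 0

/-- The value of the map on a graph `G`, computed with one point on every edge: each edge
is replaced by `P₂`, each vertex is resolved, with the factor `d ^ ((r - 2) / 2)` for every vertex
of valence `r`. -/
def phi {K : Type*} [CommRing K] (d : Kˣ) {n : ℕ} (G : Drawing n) (E : Finset (ℕ × ℕ)) :
    TemperleyLieb K (d : K) (2 * n) :=
  (G.weight d : K) • toTL (d : K) (2 * n) (cable d E 0 n G.word)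

end

end PlanarPictures

/-! The doubling is first made local: instead of one `P₂` per edge, `fullCable` puts one at every
point of the drawing. `P₂` is idempotent, because stacking two turnbacks closes a circle worth `d`
(`projector_idem`), and it slides along strands and around maxima and minima
(`Wide.cable_insert_follows`). Hence only the set of edges carrying projectors matters
(`Wide.cable_eq_cable`), and `phi` agrees with `Drawing.image` for every choice of edge points
(`phi_eq_image`). Full rows of projectors make the doubling compatible with stacking
(`fullCable_append`), so each isotopy event and each relation has to be checked only on the slices
that it changes.

These checks are short. On an inner edge between two vertices, the identity term of `P₂` gives `G/e`
and the turnback term gives `-1/d` times `G∖e`; the weights of `G` and `G/e` agree, that of `G∖e` is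
smaller by a factor `d`, and the factors cancel. A circle carrying `P₂` is worth `d² - 1`. A loop at
a vertex contributes `d - 1/d`, and its two legs contribute a weight `d`, again `d² - 1 = Q - 1`. At
a univalent vertex `P₂` meets a turnback and vanishes. What lies inside a circle or loop evaluates
to a scalar times a standard picture, the same with and without the curve (`exists_scalar`,
`exists_scalar_cup`).

The computations take place in `State d N`, where combinations of words are equal if all their
continuations agree in the Temperley-Lieb algebra; thus a relation can be applied in the middle of a
word. Words that do not start correctly from `N` strands have value zero, so the side condition of a
relation reduces to a lower bound on the number of strands, which is `Wide`.

`Drawing.image` is multiplicative and invariant under isotopy, so it extends linearly and descends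
to the quotient; uniqueness holds because classes of drawings span. -/

namespace PlanarPictures

/-! ### Words and their widths -/

theorem Runs.unique {w : List Slice} {k l m : ℕ} (h₁ : Runs k w l) (h₂ : Runs k w m) : l = m := by
  induction w generalizing k with
  | nil => exact h₁.symm.trans h₂
  | cons s w ih => exact ih h₁.2 h₂.2

theorem runs_append_iff {w₁ w₂ : List Slice} {k m : ℕ} :
    Runs k (w₁ ++ w₂) m ↔ ∃ l, Runs k w₁ l ∧ Runs l w₂ m := by
  refine ⟨fun h => ?_, fun ⟨l, h₁, h₂⟩ => h₁.append h₂⟩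
  induction w₁ generalizing k with
  | nil => exact ⟨k, rfl, h⟩
  | cons s w ih =>
    obtain ⟨l, h₁, h₂⟩ := ih h.2
    exact ⟨l, ⟨h.1, h₁⟩, h₂⟩

noncomputable section

variable {K : Type*} [CommRing K]

theorem ofWord_append (w₁ w₂ : List Slice) :
    ofWord K (w₁ ++ w₂) = ofWord K w₁ * ofWord K w₂ := by
  simp only [ofWord, FreeMonoid.ofList_append, map_mul]

theorem ofWord_nil : ofWord K [] = 1 := map_one (MonoidAlgebra.of K (FreeMonoid Slice))

theorem ofWord_cons (s : Slice) (w : List Slice) :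
    ofWord K (s :: w) = ofWord K [s] * ofWord K w := ofWord_append [s] w

@[elab_as_elim]
theorem WordAlgebra.induction {P : WordAlgebra K → Prop} (f : WordAlgebra K)
    (word : ∀ w, P (ofWord K w)) (add : ∀ f g, P f → P g → P (f + g))
    (smul : ∀ (c : K) f, P f → P (c • f)) : P f :=
  MonoidAlgebra.induction_on f (fun w => word w.toList) add smul

/-! ### The value of a combination of words in the Temperley-Lieb algebra -/

open Classical in
/-- `toTL` as a linear map. -/
def toTLₗ (d : Kˣ) (N : ℕ) : WordAlgebra K →ₗ[K] TemperleyLieb K (d : K) N where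
  toFun := toTL (d : K) N
  map_add' f g := by
    refine Finsupp.sum_add_index' (fun w => ?_) fun w b c => ?_ <;> split_ifs <;> simp [add_smul]
  map_smul' c f := by
    refine (Finsupp.sum_smul_index' fun w => ?_).trans ?_
    · split_ifs <;> simp
    · rw [RingHom.id_apply, toTL, Finsupp.smul_sum]
      refine Finsupp.sum_congr fun w _ => ?_
      split_ifs <;> simp [mul_smul]

open Classical in
theorem toTLₗ_ofWord (d : Kˣ) (N : ℕ) (w : List Slice) :
    toTLₗ d N (ofWord K w) =
      if h : Runs N w N ∧ ∀ s ∈ w, s.piece.IsArc then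
        curveClass (d : K) (⟨⟨w, h.1⟩, h.2⟩ : curves N) else 0 := by
  change toTL (d : K) N (ofWord K w) = _
  unfold toTL ofWord
  rw [MonoidAlgebra.of_apply, MonoidAlgebra.coeff_single, Finsupp.sum_single_index]
  · simp only [FreeMonoid.toList_ofList, one_smul]
  · simp

theorem toTLₗ_ofWord_of_runs (d : Kˣ) {N : ℕ} {w : List Slice} (h : Runs N w N)
    (h' : ∀ s ∈ w, s.piece.IsArc) :
    toTLₗ d N (ofWord K w) = curveClass (d : K) (⟨⟨w, h⟩, h'⟩ : curves N) := by
  rw [toTLₗ_ofWord, dif_pos ⟨h, h'⟩]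

theorem toTLₗ_ofWord_of_not_runs (d : Kˣ) {N : ℕ} {w : List Slice} (h : ¬ Runs N w N) :
    toTLₗ d N (ofWord K w) = 0 := by
  rw [toTLₗ_ofWord, dif_neg fun h' => h h'.1]

theorem toTLₗ_ofWord_of_not_arc (d : Kˣ) {N : ℕ} {w : List Slice}
    (h : ¬ ∀ s ∈ w, s.piece.IsArc) : toTLₗ d N (ofWord K w) = 0 := by
  rw [toTLₗ_ofWord, dif_neg fun h' => h h'.2]

/-- If the strand numbers do not match, or the surroundings contain a vertex, `toTL` drops both
words; otherwise they are isotopic drawings of curves. -/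
theorem toTLₗ_move (d : Kˣ) {N : ℕ} {s t : List Slice} (hm : Move s t)
    (hs : ∀ x ∈ s, x.piece.IsArc) (ht : ∀ x ∈ t, x.piece.IsArc) (u v : List Slice)
    (h : Runs N (u ++ s ++ v) N ↔ Runs N (u ++ t ++ v) N) :
    toTLₗ d N (ofWord K (u ++ s ++ v)) = toTLₗ d N (ofWord K (u ++ t ++ v)) := by
  by_cases h₁ : Runs N (u ++ s ++ v) N
  · by_cases h₂ : ∀ x ∈ u ++ v, x.piece.IsArc
    · simp only [List.mem_append] at h₂
      have hs' : ∀ x ∈ u ++ s ++ v, x.piece.IsArc := by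
        simp only [List.mem_append]; aesop
      have ht' : ∀ x ∈ u ++ t ++ v, x.piece.IsArc := by
        simp only [List.mem_append]; aesop
      rw [toTLₗ_ofWord_of_runs d h₁ hs', toTLₗ_ofWord_of_runs d (h.1 h₁) ht']
      unfold curveClass curve
      congr 2
      refine (Con.eq _).2 ?_
      exact ConGen.Rel.of _ _ ⟨u, s, t, v, hm, rfl, rfl⟩
    · rw [toTLₗ_ofWord_of_not_arc, toTLₗ_ofWord_of_not_arc] <;>
      · contrapose! h₂
        intro x hx
        refine h₂ x ?_
        simp only [List.mem_append] at hx ⊢; tauto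
  · rw [toTLₗ_ofWord_of_not_runs d h₁, toTLₗ_ofWord_of_not_runs d (fun h' => h₁ (h.2 h'))]

theorem toTLₗ_loop (d : Kˣ) {N : ℕ} (u v : List Slice) (a : ℕ)
    (h : Runs N (u ++ [⟨a, .cap⟩, ⟨a, .cup⟩] ++ v) N ↔ Runs N (u ++ v) N) :
    toTLₗ d N (ofWord K (u ++ [⟨a, .cap⟩, ⟨a, .cup⟩] ++ v)) =
      (d : K) • toTLₗ d N (ofWord K (u ++ v)) := by
  by_cases h₁ : Runs N (u ++ v) N
  · by_cases h₂ : ∀ x ∈ u ++ v, x.piece.IsArc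
    · have hs' : ∀ x ∈ u ++ [⟨a, .cap⟩, ⟨a, .cup⟩] ++ v, x.piece.IsArc := by
        simp only [List.mem_append, List.mem_cons, List.not_mem_nil, or_false] at h₂ ⊢
        rintro x ((hx | rfl | rfl) | hx)
        exacts [h₂ x (Or.inl hx), trivial, trivial, h₂ x (Or.inr hx)]
      rw [toTLₗ_ofWord_of_runs d h₁ h₂, toTLₗ_ofWord_of_runs d (h.2 h₁) hs']
      unfold curveClass
      rw [← map_smul]
      -- Circles with empty interior suffice, since the contents of a curve are always evaluated
      -- first.
      refine RingQuot.mkAlgHom_rel K (LoopRel.circle u [] v a rfl _ _ ?_ ?_) <;>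
        simp [shift, Drawing.word]
    · rw [toTLₗ_ofWord_of_not_arc, toTLₗ_ofWord_of_not_arc d h₂, smul_zero]
      contrapose! h₂
      intro x hx
      refine h₂ x ?_
      simp only [List.mem_append] at hx ⊢; tauto
  · rw [toTLₗ_ofWord_of_not_runs d h₁, toTLₗ_ofWord_of_not_runs d (fun h' => h₁ (h.1 h')), smul_zero]

/-! ### States: combinations of words up to equality in the Temperley-Lieb algebra after any
continuation -/

/-- The combinations of words all of whose continuations vanish in the Temperley-Lieb algebra. -/
def nullWords (d : Kˣ) (N : ℕ) : Submodule K (WordAlgebra K) where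
  carrier := {f | ∀ h, toTLₗ d N (f * h) = 0}
  add_mem' hf hg h := by rw [add_mul, map_add, hf, hg, add_zero]
  zero_mem' h := by rw [zero_mul, map_zero]
  smul_mem' c f hf h := by rw [smul_mul_assoc, map_smul, hf, smul_zero]

/-- Combinations of words that start with `N` strands, where two of them are identified if all
their continuations agree in the Temperley-Lieb algebra. -/
abbrev State (d : Kˣ) (N : ℕ) : Type _ := WordAlgebra K ⧸ nullWords d N

variable {d : Kˣ} {N : ℕ}

/-- The state given by a word. -/
def State.ofWord (d : Kˣ) (N : ℕ) (w : List Slice) : State d N :=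
  Submodule.Quotient.mk (PlanarPictures.ofWord K w)

/-- A state continued by a combination of words. -/
def State.act (x : State d N) (g : WordAlgebra K) : State d N :=
  (nullWords d N).mapQ (nullWords d N) (LinearMap.mulRight K g)
    (fun f hf h => by rw [LinearMap.mulRight_apply, mul_assoc]; exact hf _) x

infixl:70 " ◃ " => State.act

theorem mk_act (f g : WordAlgebra K) :
    (Submodule.Quotient.mk f : State d N) ◃ g = Submodule.Quotient.mk (f * g) := rfl

theorem mk_eq_mk_iff {f g : WordAlgebra K} :
    (Submodule.Quotient.mk f : State d N) = Submodule.Quotient.mk g ↔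
      ∀ h, toTLₗ d N (f * h) = toTLₗ d N (g * h) := by
  rw [Submodule.Quotient.eq]
  refine forall_congr' fun h => ?_
  rw [sub_mul, map_sub, sub_eq_zero]

theorem mk_eq_mk_iff_word {f g : WordAlgebra K} :
    (Submodule.Quotient.mk f : State d N) = Submodule.Quotient.mk g ↔
      ∀ w, toTLₗ d N (f * ofWord K w) = toTLₗ d N (g * ofWord K w) := by
  rw [mk_eq_mk_iff]
  refine ⟨fun h w => h _, fun h k => ?_⟩
  induction k using WordAlgebra.induction with
  | word w => exact h w
  | add f g hf hg => simp only [mul_add, map_add, hf, hg]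
  | smul c f hf => simp only [mul_smul_comm, map_smul, hf]

@[simp] theorem add_act (x y : State d N) (g : WordAlgebra K) : (x + y) ◃ g = x ◃ g + y ◃ g :=
  map_add _ _ _
@[simp] theorem sub_act (x y : State d N) (g : WordAlgebra K) : (x - y) ◃ g = x ◃ g - y ◃ g :=
  map_sub _ _ _
@[simp] theorem smul_act (c : K) (x : State d N) (g : WordAlgebra K) :
    (c • x) ◃ g = c • (x ◃ g) := map_smul _ _ _
@[simp] theorem zero_act (g : WordAlgebra K) : (0 : State d N) ◃ g = 0 := map_zero _

@[simp] theorem act_add (x : State d N) (f g : WordAlgebra K) : x ◃ (f + g) = x ◃ f + x ◃ g := by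
  induction x using Submodule.Quotient.induction_on with
  | H a => simp only [mk_act, mul_add, Submodule.Quotient.mk_add]
@[simp] theorem act_sub (x : State d N) (f g : WordAlgebra K) : x ◃ (f - g) = x ◃ f - x ◃ g := by
  induction x using Submodule.Quotient.induction_on with
  | H a => simp only [mk_act, mul_sub, Submodule.Quotient.mk_sub]
@[simp] theorem act_smul (c : K) (x : State d N) (g : WordAlgebra K) :
    x ◃ (c • g) = c • (x ◃ g) := by
  induction x using Submodule.Quotient.induction_on with
  | H a => simp only [mk_act, mul_smul_comm, Submodule.Quotient.mk_smul]
@[simp] theorem act_zero (x : State d N) : x ◃ 0 = 0 := by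
  induction x using Submodule.Quotient.induction_on with
  | H a => simp only [mk_act, mul_zero, Submodule.Quotient.mk_zero]
@[simp] theorem act_one (x : State d N) : x ◃ 1 = x := by
  induction x using Submodule.Quotient.induction_on with
  | H a => simp only [mk_act, mul_one]
theorem act_mul (x : State d N) (f g : WordAlgebra K) : x ◃ (f * g) = x ◃ f ◃ g := by
  induction x using Submodule.Quotient.induction_on with
  | H a => simp only [mk_act, mul_assoc]

theorem ofWord_act (u w : List Slice) :
    State.ofWord d N u ◃ ofWord K w = State.ofWord d N (u ++ w) := by
  rw [State.ofWord, mk_act, ← ofWord_append]; rfl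

@[elab_as_elim]
theorem State.induction {P : State d N → Prop} (x : State d N)
    (word : ∀ w, P (State.ofWord d N w)) (add : ∀ x y, P x → P y → P (x + y))
    (smul : ∀ (c : K) x, P x → P (c • x)) : P x := by
  induction x using Submodule.Quotient.induction_on with
  | H f =>
    induction f using WordAlgebra.induction with
    | word w => exact word w
    | add f g hf hg => exact add _ _ hf hg
    | smul c f hf => exact smul c _ hf

/-- A state is `k`-wide if it is a combination of words that end with at least `k` strands. -/
def Wide (x : State d N) (k : ℕ) : Prop :=
  x ∈ Submodule.span K {y | ∃ w, (∀ l, Runs N w l → k ≤ l) ∧ y = State.ofWord d N w}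

@[elab_as_elim]
theorem Wide.induction {k : ℕ} {P : State d N → Prop} {x : State d N} (hx : Wide x k)
    (word : ∀ w, (∀ l, Runs N w l → k ≤ l) → P (State.ofWord d N w))
    (add : ∀ x y, P x → P y → P (x + y))
    (smul : ∀ (c : K) x, P x → P (c • x)) : P x := by
  refine Submodule.span_induction ?_ ?_ (fun x y _ _ => add x y) (fun c x _ => smul c x) hx
  · rintro _ ⟨w, hw, rfl⟩; exact word w hw
  · have h : P ((0 : K) • State.ofWord d N [⟨N, .cup⟩]) :=
      smul _ _ (word _ fun l hl => absurd hl.1 (by simp [Piece.ins]))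
    rwa [zero_smul] at h

theorem Wide.mono {x : State d N} {k l : ℕ} (hx : Wide x k) (h : l ≤ k) : Wide x l := by
  refine Submodule.span_mono ?_ hx
  rintro _ ⟨w, hw, rfl⟩
  exact ⟨w, fun m hm => h.trans (hw m hm), rfl⟩

theorem wide_zero (x : State d N) : Wide x 0 := by
  induction x using State.induction with
  | word w => exact Submodule.subset_span ⟨w, fun _ _ => Nat.zero_le _, rfl⟩
  | add x y hx hy => exact Submodule.add_mem _ hx hy
  | smul c x hx => exact Submodule.smul_mem _ _ hx

theorem Wide.act_of_forall {k l : ℕ} {x : State d N} (hx : Wide x k) {g : WordAlgebra K}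
    (h : ∀ w, (∀ m, Runs N w m → k ≤ m) → Wide (State.ofWord d N w ◃ g) l) : Wide (x ◃ g) l := by
  refine Wide.induction hx h (fun x y hx hy => ?_) fun c x hx => ?_
  · rw [add_act]; exact Submodule.add_mem _ hx hy
  · rw [smul_act]; exact Submodule.smul_mem _ _ hx

theorem Wide.cap {k : ℕ} {x : State d N} (hx : Wide x k) (a : ℕ) :
    Wide (x ◃ ofWord K [⟨a, .cap⟩]) (k + 2) := by
  refine hx.act_of_forall fun w hw => ?_
  rw [ofWord_act]
  refine Submodule.subset_span ⟨_, fun l hl => ?_, rfl⟩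
  obtain ⟨m, h₁, h₂, h₃⟩ := runs_append_iff.1 hl
  have := hw m h₁
  simp only [Runs, Piece.ins, Piece.outs] at h₂ h₃
  omega

theorem Wide.cup {k : ℕ} {x : State d N} (hx : Wide x k) (a : ℕ) :
    Wide (x ◃ ofWord K [⟨a, .cup⟩]) (k - 2) := by
  refine hx.act_of_forall fun w hw => ?_
  rw [ofWord_act]
  refine Submodule.subset_span ⟨_, fun l hl => ?_, rfl⟩
  obtain ⟨m, h₁, h₂, h₃⟩ := runs_append_iff.1 hl
  have := hw m h₁
  simp only [Runs, Piece.ins, Piece.outs] at h₂ h₃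
  omega

/-- A piece at position `a` forces enough strands to be present: words without them do not run and
impose no condition. -/
theorem wide_cap (x : State d N) (a : ℕ) : Wide (x ◃ ofWord K [⟨a, .cap⟩]) (a + 2) := by
  refine (wide_zero x).act_of_forall fun w _ => ?_
  rw [ofWord_act]
  refine Submodule.subset_span ⟨_, fun l hl => ?_, rfl⟩
  obtain ⟨m, h₁, h₂, h₃⟩ := runs_append_iff.1 hl
  simp only [Runs, Piece.ins, Piece.outs] at h₂ h₃
  omega

theorem wide_cup (x : State d N) (a : ℕ) : Wide (x ◃ ofWord K [⟨a, .cup⟩]) a := by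
  refine (wide_zero x).act_of_forall fun w _ => ?_
  rw [ofWord_act]
  refine Submodule.subset_span ⟨_, fun l hl => ?_, rfl⟩
  obtain ⟨m, h₁, h₂, h₃⟩ := runs_append_iff.1 hl
  simp only [Runs, Piece.ins, Piece.outs] at h₂ h₃
  omega

theorem Wide.act_word {k l : ℕ} {x : State d N} (hx : Wide x k) {w : List Slice}
    (hw : Runs k w l) : Wide (x ◃ ofWord K w) l := by
  refine hx.act_of_forall fun u hu => ?_
  rw [ofWord_act]
  refine Submodule.subset_span ⟨_, fun m hm => ?_, rfl⟩
  obtain ⟨j, h₁, h₂⟩ := runs_append_iff.1 hm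
  have h₃ := hu j h₁
  clear h₁ hm hu hx
  induction w generalizing j k with
  | nil => cases hw; cases h₂; exact h₃
  | cons s w ih =>
    refine ih hw.2 _ h₂.2 ?_
    have := hw.1
    omega

theorem Wide.act_span {k l : ℕ} {x : State d N} (hx : Wide x k) {g : WordAlgebra K}
    (hg : g ∈ Submodule.span K (curveWords K k l)) : Wide (x ◃ g) l := by
  induction hg using Submodule.span_induction with
  | mem g hg => obtain ⟨w, hw, -, rfl⟩ := hg; exact hx.act_word hw
  | zero => rw [act_zero]; exact Submodule.zero_mem _
  | add f g _ _ hf hg => rw [act_add]; exact Submodule.add_mem _ hf hg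
  | smul c f _ hf => rw [act_smul]; exact Submodule.smul_mem _ _ hf

/-! ### Relations between words acting on states -/

/-- No width is required: both orders of the pieces are possible for exactly the same numbers of
strands. -/
theorem act_slide (x : State d N) (a c : ℕ) {g h : Piece} (hg : g.IsArc) (hh : h.IsArc) :
    x ◃ ofWord K [⟨a, g⟩] ◃ ofWord K [⟨a + g.outs + c, h⟩] =
      x ◃ ofWord K [⟨a + g.ins + c, h⟩] ◃ ofWord K [⟨a, g⟩] := by
  induction x using State.induction with
  | word w =>
    simp only [ofWord_act]
    refine mk_eq_mk_iff_word.2 fun v => ?_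
    simp only [← ofWord_append]
    have := toTLₗ_move d (N := N) (Move.slide a c g h) (by simp [hg, hh]) (by simp [hg, hh]) w v
      (by
        rw [List.append_assoc, List.append_assoc, runs_append_iff, runs_append_iff]
        refine exists_congr fun m => and_congr_right fun _ => ?_
        simp only [List.cons_append, List.nil_append, Runs, ← and_assoc]
        constructor
        · rintro ⟨⟨h₁, h₂⟩, h₃⟩
          refine ⟨⟨by omega, by omega⟩, ?_⟩
          convert h₃ using 1
          omega
        · rintro ⟨⟨h₁, h₂⟩, h₃⟩
          refine ⟨⟨by omega, by omega⟩, ?_⟩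
          convert h₃ using 1
          omega)
    simpa only [List.append_assoc, List.cons_append, List.nil_append] using this
  | add x y hx hy => simp only [add_act, hx, hy]
  | smul c x hx => simp only [smul_act, hx]

/-- The empty word always runs, a zigzag only if strand `a` exists; this is where the width enters.
-/
theorem Wide.zigzag_aux {k a : ℕ} {x : State d N} (hx : Wide x k) {s t : Slice}
    (hm : Move [s, t] []) (hs : s.piece = .cap) (ht : t.piece = .cup) (hsa : s.left ≤ a + 1)
    (hta : t.left ≤ a + 1)
    (h : a + 1 ≤ k) : x ◃ ofWord K [s] ◃ ofWord K [t] = x := by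
  refine Wide.induction hx (fun w hw => ?_) (fun x y hx hy => ?_) fun c x hx => ?_
  · simp only [ofWord_act]
    refine mk_eq_mk_iff_word.2 fun v => ?_
    simp only [← ofWord_append]
    have := toTLₗ_move d (N := N) hm (by simp [hs, ht, Piece.IsArc]) (by simp) w v
      (by
        rw [List.append_assoc, List.append_assoc, runs_append_iff, runs_append_iff]
        refine exists_congr fun m => and_congr_right fun hwm => ?_
        have := hw m hwm
        simp only [List.cons_append, List.nil_append, Runs, hs, ht, Piece.ins, Piece.outs]
        rw [← and_assoc, and_iff_right (by omega)]
        simp)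
    simpa only [List.append_assoc, List.cons_append, List.nil_append] using this
  · simp only [add_act, hx, hy]
  · simp only [smul_act, hx]

theorem Wide.zigzag_left {k a : ℕ} {x : State d N} (hx : Wide x k) (h : a + 1 ≤ k) :
    x ◃ ofWord K [⟨a, .cap⟩] ◃ ofWord K [⟨a + 1, .cup⟩] = x :=
  hx.zigzag_aux (Move.straighten_left a) rfl rfl (Nat.le_succ a) le_rfl h

theorem Wide.zigzag_right {k a : ℕ} {x : State d N} (hx : Wide x k) (h : a + 1 ≤ k) :
    x ◃ ofWord K [⟨a + 1, .cap⟩] ◃ ofWord K [⟨a, .cup⟩] = x :=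
  hx.zigzag_aux (Move.straighten_right a) rfl rfl le_rfl (Nat.le_succ a) h

theorem Wide.loop {k a : ℕ} {x : State d N} (hx : Wide x k) (h : a ≤ k) :
    x ◃ ofWord K [⟨a, .cap⟩] ◃ ofWord K [⟨a, .cup⟩] = (d : K) • x := by
  refine Wide.induction hx (fun w hw => ?_) (fun x y hx hy => ?_) fun c x hx => ?_
  · simp only [ofWord_act]
    refine mk_eq_mk_iff_word.2 fun v => ?_
    change toTLₗ d N (_ * _) = toTLₗ d N ((d : K) • ofWord K w * _)
    rw [smul_mul_assoc, map_smul]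
    simp only [← ofWord_append]
    have := toTLₗ_loop (K := K) d (N := N) w v a
      (by
        rw [List.append_assoc, runs_append_iff, runs_append_iff]
        refine exists_congr fun m => and_congr_right fun hwm => ?_
        have := hw m hwm
        simp only [List.cons_append, List.nil_append, Runs, Piece.ins, Piece.outs]
        rw [← and_assoc, and_iff_right (by omega)]
        simp)
    simpa only [List.append_assoc, List.cons_append, List.nil_append] using this
  · simp only [add_act, hx, hy, smul_add]
  · simp only [smul_act, hx, smul_comm c]

local notation "cap[" a "]" => ofWord _ [Slice.mk a Piece.cap]
local notation "cup[" a "]" => ofWord _ [Slice.mk a Piece.cup]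

theorem cap_cap (x : State d N) {a b : ℕ} (h : a ≤ b) :
    x ◃ cap[a] ◃ cap[b + 2] = x ◃ cap[b] ◃ cap[a] := by
  obtain ⟨c, rfl⟩ := Nat.exists_eq_add_of_le h
  rw [add_right_comm]
  exact act_slide x a c (g := .cap) (h := .cap) trivial trivial

theorem cap_cup (x : State d N) {a b : ℕ} (h : a ≤ b) :
    x ◃ cap[a] ◃ cup[b + 2] = x ◃ cup[b] ◃ cap[a] := by
  obtain ⟨c, rfl⟩ := Nat.exists_eq_add_of_le h
  rw [add_right_comm]
  exact act_slide x a c (g := .cap) (h := .cup) trivial trivial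

theorem cup_cap (x : State d N) {a b : ℕ} (h : a ≤ b) :
    x ◃ cup[a] ◃ cap[b] = x ◃ cap[b + 2] ◃ cup[a] := by
  obtain ⟨c, rfl⟩ := Nat.exists_eq_add_of_le h
  rw [add_right_comm]
  exact act_slide x a c (g := .cup) (h := .cap) trivial trivial

theorem cup_cup (x : State d N) {a b : ℕ} (h : a ≤ b) :
    x ◃ cup[a] ◃ cup[b] = x ◃ cup[b + 2] ◃ cup[a] := by
  obtain ⟨c, rfl⟩ := Nat.exists_eq_add_of_le h
  rw [add_right_comm]
  exact act_slide x a c (g := .cup) (h := .cup) trivial trivial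

/-! ### Translations and the interchange law -/

/-- Translation of combinations of words to the right by `a` strands. -/
def shiftHom (K : Type*) [CommRing K] (a : ℕ) : WordAlgebra K →ₐ[K] WordAlgebra K :=
  MonoidAlgebra.mapDomainAlgHom K K (FreeMonoid.map fun s => Slice.mk (a + s.left) s.piece)

theorem shiftHom_ofWord (a : ℕ) (w : List Slice) :
    shiftHom K a (ofWord K w) = ofWord K (shift a w) := by
  simp [shiftHom, ofWord, shift, FreeMonoid.ofList_map]

theorem shift_shift (a b : ℕ) (w : List Slice) : shift a (shift b w) = shift (a + b) w := by
  simp [shift, Function.comp_def, add_assoc]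

theorem arc_shift {a : ℕ} {w : List Slice} (h : ∀ s ∈ w, s.piece.IsArc) :
    ∀ s ∈ shift a w, s.piece.IsArc := by
  intro s hs
  obtain ⟨t, ht, rfl⟩ := List.mem_map.1 hs
  exact h t ht

theorem Runs.shift {w : List Slice} {k l : ℕ} (h : Runs k w l) (a b : ℕ) :
    Runs (a + k + b) (shift a w) (a + l + b) := by
  induction w generalizing k with
  | nil => cases h; exact rfl
  | cons s w ih =>
    have h₁ := h.1
    refine ⟨by dsimp only; omega, ?_⟩
    change Runs _ (PlanarPictures.shift a w) _
    convert ih h.2 using 1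
    dsimp only
    omega

theorem act_interchange_slice (x : State d N) {s : Slice} (hs : s.piece.IsArc) {p b : ℕ}
    (hp : s.left + s.piece.ins ≤ p) (hb : p ≤ b) {w : List Slice} (hw : ∀ t ∈ w, t.piece.IsArc) :
    x ◃ ofWord K [s] ◃ ofWord K (shift (b - s.piece.ins + s.piece.outs) w) =
      x ◃ ofWord K (shift b w) ◃ ofWord K [s] := by
  induction w generalizing x with
  | nil => simp only [shift, List.map_nil, ofWord_nil, act_one]
  | cons t w ih =>
    simp only [List.forall_mem_cons] at hw
    have h := act_slide x s.left (b + t.left - s.left - s.piece.ins) hs hw.1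
    rw [show s.left + s.piece.outs + (b + t.left - s.left - s.piece.ins) =
      b - s.piece.ins + s.piece.outs + t.left by omega,
      show s.left + s.piece.ins + (b + t.left - s.left - s.piece.ins) = b + t.left by omega] at h
    have h₁ : ∀ a, shift a (t :: w) = ⟨a + t.left, t.piece⟩ :: shift a w := fun _ => rfl
    rw [h₁, h₁, ofWord_cons ⟨_ + t.left, _⟩ (shift _ w), ofWord_cons ⟨b + t.left, _⟩, act_mul,
      act_mul, h, ih _ hw.2]

/-- `w₁` occupies the `p` columns from `a` on, and `w₂` lies to their right. The offset `c` is `b`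
corrected by the change `q - p` in the number of strands, stated additively to avoid truncated
subtraction. -/
theorem act_interchange_word (x : State d N) {w₁ : List Slice} {p q a b c : ℕ}
    (h₁ : Runs p w₁ q) (hw₁ : ∀ t ∈ w₁, t.piece.IsArc) (hb : a + p ≤ b) (hc : b + q = c + p)
    {w₂ : List Slice} (hw₂ : ∀ t ∈ w₂, t.piece.IsArc) :
    x ◃ ofWord K (shift a w₁) ◃ ofWord K (shift c w₂) =
      x ◃ ofWord K (shift b w₂) ◃ ofWord K (shift a w₁) := by
  induction w₁ generalizing x p b with
  | nil =>
    cases h₁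
    obtain rfl : b = c := by omega
    simp only [shift, List.map_nil, ofWord_nil, act_one]
  | cons s w ih =>
    simp only [List.forall_mem_cons] at hw₁
    have h₂ := h₁.1
    have h := act_interchange_slice x (s := ⟨a + s.left, s.piece⟩) hw₁.1 (p := a + p) (b := b)
      (by dsimp only; omega) hb hw₂
    have h₃ : shift a (s :: w) = ⟨a + s.left, s.piece⟩ :: shift a w := rfl
    rw [h₃, ofWord_cons, act_mul, act_mul, ← h]
    refine ih _ h₁.2 hw₁.2 (by dsimp only; omega) (by dsimp only; omega)

/-- The combinations of words without vertices. -/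
def arcSpan (K : Type*) [CommRing K] : Submodule K (WordAlgebra K) :=
  Submodule.span K {f | ∃ w : List Slice, (∀ s ∈ w, s.piece.IsArc) ∧ f = ofWord K w}

theorem curveWords_le_arcSpan {k l : ℕ} {f : WordAlgebra K}
    (h : f ∈ Submodule.span K (curveWords K k l)) : f ∈ arcSpan K := by
  refine Submodule.span_mono ?_ h
  rintro _ ⟨w, _, hw, rfl⟩
  exact ⟨w, hw, rfl⟩

/-- Combinations of pictures that lie side by side exchange their heights. -/
theorem act_interchange (x : State d N) {f g : WordAlgebra K} {p q a b c : ℕ}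
    (hf : f ∈ Submodule.span K (curveWords K p q)) (hg : g ∈ arcSpan K)
    (hb : a + p ≤ b) (hc : b + q = c + p) :
    x ◃ shiftHom K a f ◃ shiftHom K c g = x ◃ shiftHom K b g ◃ shiftHom K a f := by
  induction hf using Submodule.span_induction with
  | mem f hf =>
    obtain ⟨w₁, h₁, hw₁, rfl⟩ := hf
    induction hg using Submodule.span_induction with
    | mem g hg =>
      obtain ⟨w₂, hw₂, rfl⟩ := hg
      simp only [shiftHom_ofWord]
      exact act_interchange_word x h₁ hw₁ hb hc hw₂
    | zero => simp only [map_zero, act_zero, zero_act]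
    | add f g _ _ hf hg => simp only [map_add, act_add, add_act, hf, hg]
    | smul c f _ hf => simp only [map_smul, act_smul, smul_act, hf]
  | zero => simp only [map_zero, act_zero, zero_act]
  | add f g _ _ hf hg => simp only [map_add, act_add, add_act, hf, hg]
  | smul c f _ hf => simp only [map_smul, act_smul, smul_act, hf]

theorem shiftHom_shiftHom (a b : ℕ) (f : WordAlgebra K) :
    shiftHom K a (shiftHom K b f) = shiftHom K (a + b) f := by
  induction f using WordAlgebra.induction with
  | word w => simp only [shiftHom_ofWord, shift_shift]
  | add f g hf hg => simp only [map_add, hf, hg]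
  | smul c f hf => simp only [map_smul, hf]

/-! ### Doubled pieces and projectors -/

theorem double_eq_shift (s : Slice) : double s = shift (2 * s.left) (double ⟨0, s.piece⟩) := by
  obtain ⟨a, _ | _ | ⟨_ | p, _ | q⟩⟩ := s <;> simp [double, shift]

theorem ofWord_double (s : Slice) :
    ofWord K (double s) = shiftHom K (2 * s.left) (ofWord K (double ⟨0, s.piece⟩)) := by
  rw [shiftHom_ofWord, ← double_eq_shift]

theorem double_mem_span (g : Piece) :
    ofWord K (double ⟨0, g⟩) ∈ Submodule.span K (curveWords K (2 * g.ins) (2 * g.outs)) := by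
  refine Submodule.subset_span ⟨_, ?_, isArc_double _, rfl⟩
  have := runs_double (m := g.ins) ⟨0, g⟩ (by simp)
  simpa using this

theorem projector_eq_shift (j : ℕ) : projector d j = shiftHom K (2 * j) (projector d 0) := by
  simp [projector, shiftHom_ofWord, shift]

theorem projector_mem_span : projector d 0 ∈ Submodule.span K (curveWords K 2 2) := by
  have := projectors_mem_span d {(0, 0)} 0 1
  simpa [projectors, List.range_succ] using this

theorem projector_mem_arcSpan : projector d 0 ∈ arcSpan K :=
  curveWords_le_arcSpan projector_mem_span

theorem act_projector (x : State d N) (j : ℕ) :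
    x ◃ projector d j = x - ((d⁻¹ : Kˣ) : K) • (x ◃ cup[2 * j] ◃ cap[2 * j]) := by
  rw [projector, act_sub, act_one, act_smul, ofWord_cons, act_mul]

theorem projector_comm (x : State d N) (i j : ℕ) :
    x ◃ projector d i ◃ projector d j = x ◃ projector d j ◃ projector d i := by
  wlog h : i < j generalizing i j
  · rcases (not_lt.1 h).lt_or_eq with h' | rfl
    · exact (this j i h').symm
    · rfl
  rw [projector_eq_shift i, projector_eq_shift j]
  exact act_interchange x projector_mem_span projector_mem_arcSpan (by omega) rfl

/-- Stacking the turnback on itself closes a circle, whose value `d` cancels one factor `1/d`. -/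
theorem projector_idem (x : State d N) (j : ℕ) :
    x ◃ projector d j ◃ projector d j = x ◃ projector d j := by
  have h : x ◃ cup[2 * j] ◃ cap[2 * j] ◃ cup[2 * j] = (d : K) • (x ◃ cup[2 * j]) :=
    (wide_cup x _).loop le_rfl
  rw [act_projector (x ◃ _), act_projector]
  simp only [sub_act, smul_act, h, smul_smul, Units.inv_mul, one_smul, sub_self, zero_act,
    smul_zero, sub_zero]

theorem projector_pass_left (x : State d N) {s : Slice} {j : ℕ} (h : j < s.left) :
    x ◃ ofWord K (double s) ◃ projector d j = x ◃ projector d j ◃ ofWord K (double s) := by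
  rw [ofWord_double, projector_eq_shift j]
  exact (act_interchange x projector_mem_span (curveWords_le_arcSpan (double_mem_span _))
    (by omega) rfl).symm

theorem projector_pass_right (x : State d N) (s : Slice) (j : ℕ) :
    x ◃ ofWord K (double s) ◃ projector d (s.left + s.piece.outs + j) =
      x ◃ projector d (s.left + s.piece.ins + j) ◃ ofWord K (double s) := by
  rw [ofWord_double, projector_eq_shift (_ + _ + j), projector_eq_shift (_ + _ + j)]
  exact act_interchange x (double_mem_span _) projector_mem_arcSpan (by omega) (by omega)

theorem act_double_cap (x : State d N) (a : ℕ) :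
    x ◃ ofWord K (double ⟨a, .cap⟩) = x ◃ cap[2 * a] ◃ cap[2 * a + 1] := by
  rw [double, ofWord_cons, act_mul]

theorem act_double_cup (x : State d N) (a : ℕ) :
    x ◃ ofWord K (double ⟨a, .cup⟩) = x ◃ cup[2 * a + 1] ◃ cup[2 * a] := by
  rw [double, ofWord_cons, act_mul]

/-- A turnback on either side of a doubled maximum cuts it into two maxima side by side. -/
theorem projector_cap (x : State d N) (a : ℕ) :
    x ◃ ofWord K (double ⟨a, .cap⟩) ◃ projector d a =
      x ◃ ofWord K (double ⟨a, .cap⟩) ◃ projector d (a + 1) := by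
  have hx := wide_cap x (2 * a)
  rw [act_double_cap, act_projector, act_projector, mul_add_one,
    hx.zigzag_right (Nat.le_succ _), hx.zigzag_left le_rfl, cap_cap x le_rfl]

theorem Wide.projector_cup {x : State d N} {k a : ℕ} (hx : Wide x k) (h : 2 * a + 4 ≤ k) :
    x ◃ projector d a ◃ ofWord K (double ⟨a, .cup⟩) =
      x ◃ projector d (a + 1) ◃ ofWord K (double ⟨a, .cup⟩) := by
  rw [act_double_cup, act_double_cup, act_projector, act_projector, mul_add_one]
  simp only [sub_act, smul_act]
  rw [(hx.cup _).zigzag_left (by omega), (hx.cup _).zigzag_right (by omega), cup_cup x le_rfl]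

/-! ### The choice of the points that carry the projectors -/

theorem projectors_congr {E E' : Finset (ℕ × ℕ)} {i m : ℕ}
    (h : ∀ j < m, (i, j) ∈ E ↔ (i, j) ∈ E') : projectors d E i m = projectors d E' i m := by
  unfold projectors
  congr 1
  refine List.map_congr_left fun j hj => ?_
  simp only [h j (List.mem_range.1 hj)]

theorem act_projectors_insert (x : State d N) (E : Finset (ℕ × ℕ)) {i j m : ℕ} (hj : j < m) :
    x ◃ projectors d (insert (i, j) E) i m = x ◃ projector d j ◃ projectors d E i m := by
  have comm : ∀ (x : State d N) (r : ℕ) (p : Prop) [Decidable p],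
      x ◃ (if p then projector d r else 1) ◃ projector d j =
        x ◃ projector d j ◃ (if p then projector d r else 1) := by
    intro x r p _
    split_ifs
    · exact projector_comm x r j
    · rw [act_one, act_one]
  -- Behind a projector on strand `j`, a further one on the same strand makes no difference.
  have h₁ : ∀ (L : List ℕ) (x : State d N),
      x ◃ projector d j ◃
        (L.map fun r => if (i, r) ∈ insert (i, j) E then projector d r else 1).prod =
      x ◃ projector d j ◃ (L.map fun r => if (i, r) ∈ E then projector d r else 1).prod := by
    intro L
    induction L with
    | nil => intro x; rfl
    | cons r L ih =>
      intro x
      simp only [List.map_cons, List.prod_cons, act_mul]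
      rw [← comm x, ← comm x, ih]
      by_cases hr : r = j
      · subst hr
        rw [if_pos (Finset.mem_insert_self _ _), projector_idem]
        split_ifs
        · rw [projector_idem]
        · rw [act_one]
      · simp [hr]
  -- A row that contains the projector on strand `j` releases a second copy of it at the front.
  have h₂ : ∀ (L : List ℕ) (x : State d N), j ∈ L →
      x ◃ (L.map fun r => if (i, r) ∈ insert (i, j) E then projector d r else 1).prod =
      x ◃ projector d j ◃
        (L.map fun r => if (i, r) ∈ insert (i, j) E then projector d r else 1).prod := by
    intro L
    induction L with
    | nil => intro x h; simp at h
    | cons r L ih =>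
      intro x h
      simp only [List.map_cons, List.prod_cons, act_mul]
      by_cases hr : r = j
      · subst hr
        rw [if_pos (Finset.mem_insert_self _ _), projector_idem]
      · rw [ih _ ((List.mem_cons.1 h).resolve_left (Ne.symm hr)), comm]
  exact (h₂ _ x (List.mem_range.2 hj)).trans (h₁ _ x)

theorem cable_congr {E E' : Finset (ℕ × ℕ)} {i m : ℕ} {w : List Slice}
    (h : ∀ r ≥ i, ∀ j, (r, j) ∈ E ↔ (r, j) ∈ E') : cable d E i m w = cable d E' i m w := by
  induction w generalizing i m with
  | nil => exact projectors_congr fun j _ => h i le_rfl j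
  | cons s w ih =>
    rw [cable, cable, projectors_congr fun j _ => h i le_rfl j,
      ih fun r hr => h r (Nat.le_of_succ_le hr)]

theorem act_cable_cons (x : State d N) (E : Finset (ℕ × ℕ)) (i m : ℕ) (s : Slice)
    (w : List Slice) :
    x ◃ cable d E i m (s :: w) = x ◃ projectors d E i m ◃ ofWord K (double s) ◃
      cable d E (i + 1) (m - s.piece.ins + s.piece.outs) w := by
  rw [cable, act_mul, act_mul]

theorem act_cable_insert (x : State d N) (E : Finset (ℕ × ℕ)) {i j m : ℕ} (hj : j < m)
    (w : List Slice) :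
    x ◃ cable d (insert (i, j) E) i m w = x ◃ projector d j ◃ cable d E i m w := by
  cases w with
  | nil => exact act_projectors_insert x E hj
  | cons s w =>
    rw [act_cable_cons, act_cable_cons, act_projectors_insert x E hj,
      cable_congr (E := insert (i, j) E) (E' := E)]
    intro r hr l
    simp [show r ≠ i by omega]

/-- Needed because `Follows.pass_right` also links points beyond the last strand; such points carry
no projector. -/
theorem cable_insert_of_le (E : Finset (ℕ × ℕ)) {i j m : ℕ} (hj : m ≤ j) (w : List Slice) :
    cable d (insert (i, j) E) i m w = cable d E i m w := by
  have h : projectors d (insert (i, j) E) i m = projectors d E i m :=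
    projectors_congr fun r hr => by simp [show r ≠ j by omega]
  cases w with
  | nil => exact h
  | cons s w =>
    rw [cable, cable, h, cable_congr (E := insert (i, j) E) (E' := E)]
    intro r hr l
    simp [show r ≠ i by omega]

theorem act_cable_cons_insert (x : State d N) (E : Finset (ℕ × ℕ)) (i r j m : ℕ) (s : Slice)
    (w : List Slice) :
    x ◃ cable d (insert (i + (r + 1), j) E) i m (s :: w) =
      x ◃ projectors d E i m ◃ ofWord K (double s) ◃
        cable d (insert (i + 1 + r, j) E) (i + 1) (m - s.piece.ins + s.piece.outs) w := by
  rw [act_cable_cons, projectors_congr (E' := E), show i + (r + 1) = i + 1 + r by omega]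
  intro l _
  simp

theorem projectors_act_comm (x : State d N) (E : Finset (ℕ × ℕ)) (i m j : ℕ) :
    x ◃ projectors d E i m ◃ projector d j = x ◃ projector d j ◃ projectors d E i m := by
  unfold projectors
  induction List.range m generalizing x with
  | nil => simp
  | cons r L ih =>
    simp only [List.map_cons, List.prod_cons, act_mul]
    rw [ih]
    split_ifs
    · rw [projector_comm]
    · rw [act_one, act_one]

theorem Wide.act_projectors {x : State d N} {m : ℕ} (hx : Wide x (2 * m))
    (E : Finset (ℕ × ℕ)) (i : ℕ) : Wide (x ◃ projectors d E i m) (2 * m) :=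
  hx.act_span (projectors_mem_span d E i m)

theorem Wide.act_double {x : State d N} {m : ℕ} (hx : Wide x (2 * m)) {s : Slice}
    (hs : s.left + s.piece.ins ≤ m) :
    Wide (x ◃ ofWord K (double s)) (2 * (m - s.piece.ins + s.piece.outs)) :=
  hx.act_word (runs_double s hs)

/-- One step of a projector along an edge. At the first slice this is one of the passing rules for
doubled pieces; further down it follows by induction on the word. -/
theorem Wide.cable_insert_follows {w : List Slice} {m n : ℕ} {x : State d N}
    (hx : Wide x (2 * m)) (hw : Runs m w n) {y z : ℕ × ℕ} (h : Follows w y z)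
    (E : Finset (ℕ × ℕ)) (i : ℕ) :
    x ◃ cable d (insert (i + y.1, y.2) E) i m w = x ◃ cable d (insert (i + z.1, z.2) E) i m w := by
  induction w generalizing i m x y z with
  | nil => cases h <;> simp at *
  | cons s w ih =>
    have hs := hw.1
    have hx' : Wide (x ◃ projectors d E i m ◃ ofWord K (double s)) _ :=
      (hx.act_projectors E i).act_double hs
    have ih' := fun {y z : ℕ × ℕ} (h : Follows w y z) => ih hx' hw.2 h (i + 1)
    cases h with
    | pass_left r j t ht hj =>
      cases r with
      | zero =>
        obtain rfl : s = t := by simpa using ht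
        change x ◃ cable d (insert (i, j) E) i m _ = x ◃ cable d (insert (i + (0 + 1), j) E) i m _
        rw [act_cable_insert _ _ (by omega), act_cable_cons_insert, add_zero,
          act_cable_insert _ _ (by omega), act_cable_cons, projector_pass_left _ hj,
          projectors_act_comm]
      | succ r =>
        rw [act_cable_cons_insert x E i r j, act_cable_cons_insert x E i (r + 1) j]
        have h := ih' (.pass_left r j t (by simpa using ht) hj)
        exact h
    | pass_right r j t ht =>
      cases r with
      | zero =>
        obtain rfl : s = t := by simpa using ht
        change x ◃ cable d (insert (i, _) E) i m _ = x ◃ cable d (insert (i + (0 + 1), _) E) i m _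
        rw [act_cable_cons_insert, add_zero]
        by_cases hj : s.left + s.piece.ins + j < m
        · rw [act_cable_insert _ _ hj, act_cable_insert _ _ (by omega), act_cable_cons,
            projector_pass_right, projectors_act_comm]
        · rw [cable_insert_of_le _ (by omega), cable_insert_of_le _ (by omega), act_cable_cons]
      | succ r =>
        rw [act_cable_cons_insert x E i r, act_cable_cons_insert x E i (r + 1)]
        have h := ih' (.pass_right r j t (by simpa using ht))
        exact h
    | cap r a ht =>
      dsimp only
      rw [act_cable_cons_insert, act_cable_cons_insert]
      cases r with
      | zero =>
        obtain rfl : s = ⟨a, .cap⟩ := by simpa using ht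
        have hs' : a ≤ m := hs
        rw [add_zero, act_cable_insert _ _ (by simp only [Piece.ins, Piece.outs]; omega),
          act_cable_insert _ _ (by simp only [Piece.ins, Piece.outs]; omega), projector_cap]
      | succ r =>
        have h := ih' (.cap r a (by simpa using ht))
        exact h
    | cup r a ht =>
      cases r with
      | zero =>
        obtain rfl : s = ⟨a, .cup⟩ := by simpa using ht
        have hs' : a + 2 ≤ m := hs
        change x ◃ cable d (insert (i, a) E) i m _ = x ◃ cable d (insert (i, a + 1) E) i m _
        rw [act_cable_insert _ _ (by omega), act_cable_insert _ _ (by omega), act_cable_cons,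
          act_cable_cons, ← projectors_act_comm, ← projectors_act_comm,
          (hx.act_projectors E i).projector_cup (by omega)]
      | succ r =>
        dsimp only
        rw [act_cable_cons_insert, act_cable_cons_insert]
        have h := ih' (.cup r a (by simpa using ht))
        exact h

theorem Wide.cable_insert_sameEdge {w : List Slice} {m n : ℕ} {x : State d N}
    (hx : Wide x (2 * m)) (hw : Runs m w n) {y z : ℕ × ℕ} (h : SameEdge w y z)
    (E : Finset (ℕ × ℕ)) :
    x ◃ cable d (insert y E) 0 m w = x ◃ cable d (insert z E) 0 m w := by
  induction h with
  | rel y z h => simpa using hx.cable_insert_follows hw h E 0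
  | refl => rfl
  | symm _ _ _ ih => exact ih.symm
  | trans _ _ _ _ _ ih₁ ih₂ => exact ih₁.trans ih₂

/-- Each extra projector slides along its edge to a point that already carries one and is absorbed
there. -/
theorem Wide.cable_union {w : List Slice} {m n : ℕ} {x : State d N}
    (hx : Wide x (2 * m)) (hw : Runs m w n) {E E' : Finset (ℕ × ℕ)}
    (h : ∀ y ∈ E', ∃ z ∈ E, SameEdge w y z) :
    x ◃ cable d (E ∪ E') 0 m w = x ◃ cable d E 0 m w := by
  induction E' using Finset.induction_on with
  | empty => rw [Finset.union_empty]
  | insert y E' _ ih =>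
    obtain ⟨z, hz, hyz⟩ := h y (Finset.mem_insert_self _ _)
    rw [Finset.union_insert, hx.cable_insert_sameEdge hw hyz,
      Finset.insert_eq_of_mem (Finset.mem_union_left _ hz)]
    exact ih fun y hy => h y (Finset.mem_insert_of_mem hy)

/-- Only the set of edges that carry projectors matters. -/
theorem Wide.cable_eq_cable {w : List Slice} {m n : ℕ} {x : State d N}
    (hx : Wide x (2 * m)) (hw : Runs m w n) {E E' : Finset (ℕ × ℕ)}
    (h : ∀ y ∈ E, ∃ z ∈ E', SameEdge w y z) (h' : ∀ y ∈ E', ∃ z ∈ E, SameEdge w y z) :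
    x ◃ cable d E 0 m w = x ◃ cable d E' 0 m w := by
  rw [← hx.cable_union hw h', Finset.union_comm, hx.cable_union hw h]

/-! ### Blocks of projectors -/

/-- The projectors on the doubles of the strands `a, …, a + m - 1`. -/
def projBlock (d : Kˣ) (a m : ℕ) : WordAlgebra K :=
  ((List.range m).map fun j => projector d (a + j)).prod

@[simp] theorem projBlock_zero (a : ℕ) : projBlock d a 0 = 1 := rfl

@[simp] theorem projBlock_one (a : ℕ) : projBlock d a 1 = projector d a := by
  simp [projBlock]

theorem projBlock_add (a m k : ℕ) :
    projBlock d a (m + k) = projBlock d a m * projBlock d (a + m) k := by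
  simp [projBlock, List.range_add, Function.comp_def, add_assoc]

theorem projBlock_succ (a m : ℕ) :
    projBlock d a (m + 1) = projBlock d a m * projector d (a + m) := by
  rw [projBlock_add, projBlock_one]

theorem shiftHom_projBlock (b a m : ℕ) :
    shiftHom K (2 * b) (projBlock d a m) = projBlock d (b + a) m := by
  have h : ∀ j, shiftHom K (2 * b) (projector d (a + j)) = projector d (b + a + j) := by
    intro j
    rw [projector_eq_shift, projector_eq_shift (b + a + j), shiftHom_shiftHom]
    congr 2
    omega
  simp [projBlock, map_list_prod, Function.comp_def, h]

theorem projectors_eq_projBlock {E : Finset (ℕ × ℕ)} {i m : ℕ} (h : ∀ j < m, (i, j) ∈ E) :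
    projectors d E i m = projBlock d 0 m := by
  unfold projectors projBlock
  congr 1
  refine List.map_congr_left fun j hj => ?_
  rw [if_pos (h j (List.mem_range.1 hj)), zero_add]

theorem projectors_eq_one {E : Finset (ℕ × ℕ)} {i m : ℕ} (h : ∀ j < m, (i, j) ∉ E) :
    projectors d E i m = 1 := by
  unfold projectors
  refine List.prod_eq_one fun y hy => ?_
  obtain ⟨j, hj, rfl⟩ := List.mem_map.1 hy
  rw [if_neg (h j (List.mem_range.1 hj))]

theorem projBlock_mem_span (m : ℕ) :
    projBlock d 0 m ∈ Submodule.span K (curveWords K (2 * m) (2 * m)) := by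
  rw [← projectors_eq_projBlock (E := (Finset.range m).image fun j => (0, j)) (i := 0)]
  · exact projectors_mem_span _ _ _ _
  · intro j hj; simpa using hj

/-- A block of projectors passes a picture if each of its projectors does. -/
theorem projBlock_pass {f : WordAlgebra K} {a b m : ℕ}
    (h : ∀ (x : State d N), ∀ j < m,
      x ◃ f ◃ projector d (b + j) = x ◃ projector d (a + j) ◃ f) (x : State d N) :
    x ◃ f ◃ projBlock d b m = x ◃ projBlock d a m ◃ f := by
  induction m with
  | zero => simp
  | succ m ih =>
    rw [projBlock_succ, projBlock_succ, act_mul, act_mul,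
      ih fun x j hj => h x j (hj.trans (Nat.lt_succ_self m)), h _ _ (Nat.lt_succ_self m)]

theorem projBlock_comm_projector (x : State d N) (a m j : ℕ) :
    x ◃ projector d j ◃ projBlock d a m = x ◃ projBlock d a m ◃ projector d j :=
  projBlock_pass (fun x _ _ => projector_comm x _ _) x

theorem projBlock_comm (x : State d N) (a m b k : ℕ) :
    x ◃ projBlock d b k ◃ projBlock d a m = x ◃ projBlock d a m ◃ projBlock d b k :=
  projBlock_pass (fun x j _ => projBlock_comm_projector x b k (a + j) |>.symm) x

theorem projBlock_absorb (x : State d N) {a m b k : ℕ} (h : a ≤ b) (h' : b + k ≤ a + m) :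
    x ◃ projBlock d a m ◃ projBlock d b k = x ◃ projBlock d a m := by
  have h₁ : ∀ j, a ≤ j → j < a + m → ∀ x : State d N,
      x ◃ projBlock d a m ◃ projector d j = x ◃ projBlock d a m := by
    intro j hj hj' x
    obtain ⟨r, rfl⟩ := Nat.exists_eq_add_of_le hj
    obtain ⟨t, rfl⟩ : ∃ t, m = r + 1 + t := ⟨m - (r + 1), by omega⟩
    rw [projBlock_add, act_mul, ← projBlock_comm_projector, projBlock_succ, act_mul,
      projector_idem]
  induction k with
  | zero => simp
  | succ k ih => rw [projBlock_succ, act_mul, ih (by omega), h₁ _ (by omega) (by omega)]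

theorem projBlock_idem (x : State d N) (a m : ℕ) :
    x ◃ projBlock d a m ◃ projBlock d a m = x ◃ projBlock d a m :=
  projBlock_absorb x le_rfl le_rfl

theorem projBlock_pass_left (x : State d N) {s : Slice} {a m : ℕ} (h : a + m ≤ s.left) :
    x ◃ ofWord K (double s) ◃ projBlock d a m = x ◃ projBlock d a m ◃ ofWord K (double s) :=
  projBlock_pass (fun x j _ => projector_pass_left x (by omega)) x

theorem projBlock_pass_right (x : State d N) (s : Slice) {a b m : ℕ}
    (h : s.left + s.piece.ins ≤ a) (h' : b + s.piece.ins = a + s.piece.outs) :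
    x ◃ ofWord K (double s) ◃ projBlock d b m = x ◃ projBlock d a m ◃ ofWord K (double s) := by
  refine projBlock_pass (fun x j _ => ?_) x
  rw [show b + j = s.left + s.piece.outs + (a - s.left - s.piece.ins + j) by omega,
    projector_pass_right]
  congr 3
  omega

/-! ### The doubling with projectors at all points -/

/-- Double all strands and vertices of a word that starts with `m` strands, and insert `P₂` at all
points. -/
def fullCable (d : Kˣ) : ℕ → List Slice → WordAlgebra K
  | m, [] => projBlock d 0 m
  | m, s :: w =>
      projBlock d 0 m * ofWord K (double s) * fullCable d (m - s.piece.ins + s.piece.outs) w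

theorem act_fullCable_cons (x : State d N) (m : ℕ) (s : Slice) (w : List Slice) :
    x ◃ fullCable d m (s :: w) = x ◃ projBlock d 0 m ◃ ofWord K (double s) ◃
      fullCable d (m - s.piece.ins + s.piece.outs) w := by
  rw [fullCable, act_mul, act_mul]

theorem cable_eq_fullCable {E : Finset (ℕ × ℕ)} {w : List Slice} {i m : ℕ}
    (h : ∀ r ≤ w.length, ∀ j < width m w r, (i + r, j) ∈ E) :
    cable d E i m w = fullCable d m w := by
  induction w generalizing i m with
  | nil => exact projectors_eq_projBlock fun j hj => h 0 le_rfl j hj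
  | cons s w ih =>
    have h₀ : ∀ j < m, (i, j) ∈ E := fun j hj => h 0 (Nat.zero_le _) j hj
    rw [cable, fullCable, projectors_eq_projBlock h₀, ih]
    intro r hr j hj
    have := h (r + 1) (by simpa using hr) j hj
    rwa [show i + 1 + r = i + (r + 1) by omega]

theorem fullCable_mem_span {w : List Slice} {m n : ℕ} (h : Runs m w n) :
    fullCable d m w ∈ Submodule.span K (curveWords K (2 * m) (2 * n)) := by
  induction w generalizing m with
  | nil => cases h; exact projBlock_mem_span _
  | cons s w ih =>
    refine mul_mem_span_curveWords (mul_mem_span_curveWords (projBlock_mem_span m) ?_) (ih h.2)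
    exact Submodule.subset_span ⟨_, runs_double s h.1, isArc_double s, rfl⟩

theorem projBlock_fullCable (x : State d N) (m : ℕ) (w : List Slice) :
    x ◃ projBlock d 0 m ◃ fullCable d m w = x ◃ fullCable d m w := by
  cases w with
  | nil => exact projBlock_idem x 0 m
  | cons s w => rw [act_fullCable_cons, projBlock_idem, ← act_fullCable_cons]

/-- At the cut both factors carry a full row of projectors where the stacked word has one;
idempotence merges them. One projector per edge would not be compatible with cutting in this way. -/
theorem fullCable_append (x : State d N) {w₁ w₂ : List Slice} {k l : ℕ} (h : Runs k w₁ l) :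
    x ◃ fullCable d k (w₁ ++ w₂) = x ◃ fullCable d k w₁ ◃ fullCable d l w₂ := by
  induction w₁ generalizing k x with
  | nil =>
    cases h
    exact (projBlock_fullCable x _ w₂).symm
  | cons s w ih => rw [List.cons_append, act_fullCable_cons, act_fullCable_cons, ih _ h.2]

theorem fullCable_projBlock (x : State d N) {w : List Slice} {k l : ℕ} (h : Runs k w l) :
    x ◃ fullCable d k w ◃ projBlock d 0 l = x ◃ fullCable d k w := by
  rw [show projBlock d 0 l = fullCable d l [] from rfl, ← fullCable_append x h, List.append_nil]

/-! ### Independence of the chosen edge points. -/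

/-- The points of a drawing. -/
def Drawing.points {n : ℕ} (G : Drawing n) : Finset (ℕ × ℕ) :=
  (Finset.range (G.word.length + 1)).biUnion fun i =>
    (Finset.range (width n G.word i)).image fun j => (i, j)

theorem Drawing.mem_points {n : ℕ} (G : Drawing n) (x : ℕ × ℕ) : x ∈ G.points ↔ G.Point x := by
  obtain ⟨i, j⟩ := x
  simp only [points, Finset.mem_biUnion, Finset.mem_range, Finset.mem_image, Prod.mk.injEq,
    Drawing.Point, Nat.lt_succ_iff]
  constructor
  · rintro ⟨i', hi, j', hj, rfl, rfl⟩; exact ⟨hi, hj⟩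
  · rintro ⟨hi, hj⟩; exact ⟨i, hi, j, hj, rfl, rfl⟩

/-- This gives uniqueness its force: the prescribed values of the homomorphism are conditional on a
set of edge points. One representative is chosen in each class of points on the same edge. -/
theorem Drawing.exists_edgePoints {n : ℕ} (G : Drawing n) : ∃ E, G.EdgePoints E := by
  classical
  let S : Setoid {x // x ∈ G.points} :=
    (Relation.EqvGen.setoid (Follows G.word)).comap Subtype.val
  have hS : ∀ x y : {x // x ∈ G.points}, S x y ↔ SameEdge G.word x.1 y.1 := fun _ _ => Iff.rfl
  let rep : {x // x ∈ G.points} → {x // x ∈ G.points} := fun x => (Quotient.mk S x).out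
  refine ⟨G.points.attach.image fun x => (rep x).1, fun x hx => ?_, fun x hx => ?_⟩
  · obtain ⟨y, -, rfl⟩ := Finset.mem_image.1 hx
    exact (G.mem_points _).1 (rep y).2
  · have hx' := (G.mem_points x).2 hx
    refine ⟨(rep ⟨x, hx'⟩).1, ⟨Finset.mem_image.2 ⟨⟨x, hx'⟩, Finset.mem_attach _ _, rfl⟩, ?_⟩, ?_⟩
    · exact (hS _ _).1 (S.symm (Quotient.mk_out (s := S) ⟨x, hx'⟩))
    · rintro y ⟨hy, hxy⟩
      obtain ⟨z, -, rfl⟩ := Finset.mem_image.1 hy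
      have h₁ : S (rep z) z := Quotient.mk_out (s := S) z
      have h₂ : S ⟨x, hx'⟩ z := S.trans ((hS ⟨x, hx'⟩ (rep z)).2 hxy) h₁
      have h₃ : Quotient.mk S ⟨x, hx'⟩ = Quotient.mk S z := Quotient.sound h₂
      simp only [rep, h₃]

/-- The image of a graph, computed with projectors at all points. -/
def Drawing.image (d : Kˣ) {n : ℕ} (G : Drawing n) : TemperleyLieb K (d : K) (2 * n) :=
  (G.weight d : K) • toTLₗ d (2 * n) (fullCable d n G.word)

/-- The state of no word at all. -/
def State.one (d : Kˣ) (N : ℕ) : State d N := Submodule.Quotient.mk 1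

theorem wide_one (N : ℕ) : Wide (State.one d N) N :=
  Submodule.subset_span ⟨[], fun _ hl => hl.le, by rw [State.ofWord, ofWord_nil]; rfl⟩

theorem toTLₗ_eq_of_act_eq {f g : WordAlgebra K}
    (h : State.one d N ◃ f = State.one d N ◃ g) : toTLₗ d N f = toTLₗ d N g := by
  rw [State.one, mk_act, mk_act, one_mul, one_mul, mk_eq_mk_iff] at h
  simpa using h 1

theorem phi_eq_image {n : ℕ} {G : Drawing n} {E : Finset (ℕ × ℕ)} (h : G.EdgePoints E) :
    phi d G E = G.image d := by
  unfold phi Drawing.image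
  change _ • toTLₗ d (2 * n) _ = _
  congr 1
  refine toTLₗ_eq_of_act_eq ?_
  rw [(wide_one (2 * n)).cable_eq_cable (w := G.word) G.2 (E := E) (E' := G.points) ?_ ?_, cable_eq_fullCable]
  · intro i hi j hj
    rw [zero_add]
    exact (G.mem_points _).2 ⟨hi, hj⟩
  · exact fun y hy => ⟨y, (G.mem_points y).2 (h.1 y hy), .refl y⟩
  · intro y hy
    obtain ⟨z, ⟨hz, hyz⟩, -⟩ := h.2 y ((G.mem_points y).1 hy)
    exact ⟨z, hz, hyz⟩

local notation "caps[" a "," k "]" => ofWord _ (List.replicate k (Slice.mk a Piece.cap))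
local notation "cups[" a "," k "]" => ofWord _ (List.replicate k (Slice.mk a Piece.cup))

/-! ### Words of two slices -/

/-- A strand between two slices passes one of them. -/
def Passes (s t : Slice) (j : ℕ) : Prop :=
  j < s.left ∨ s.left + s.piece.outs ≤ j ∨ j < t.left ∨ t.left + t.piece.ins ≤ j

theorem Passes.exists_sameEdge {s t : Slice} {j : ℕ} (h : Passes s t j) :
    ∃ z : ℕ × ℕ, SameEdge [s, t] (1, j) z ∧ (z.1 = 0 ∨ z.1 = 2) := by
  rcases h with h | h | h | h
  · exact ⟨(0, j), .symm _ _ (.rel _ _ (.pass_left 0 j s rfl h)), Or.inl rfl⟩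
  · obtain ⟨r, rfl⟩ := Nat.exists_eq_add_of_le h
    exact ⟨(0, _), .symm _ _ (.rel _ _ (.pass_right 0 r s rfl)), Or.inl rfl⟩
  · exact ⟨(2, j), .rel _ _ (.pass_left 1 j t rfl h), Or.inr rfl⟩
  · obtain ⟨r, rfl⟩ := Nat.exists_eq_add_of_le h
    exact ⟨(2, _), .rel _ _ (.pass_right 1 r t rfl), Or.inr rfl⟩

/-- Reduces the middle row to the projectors in `T`: an edge that leaves the middle level through
the top or bottom already has a projector there. -/
theorem Wide.fullCable_pair {x : State d N} {s t : Slice} {m n : ℕ} (hx : Wide x (2 * m))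
    (hw : Runs m [s, t] n) (T : Finset (ℕ × ℕ))
    (h : ∀ j < m - s.piece.ins + s.piece.outs, ∃ j', SameEdge [s, t] (1, j) (1, j') ∧
      (Passes s t j' ∨ (1, j') ∈ T)) :
    x ◃ fullCable d m [s, t] =
      x ◃ projBlock d 0 m ◃ ofWord K (double s) ◃
        projectors d T 1 (m - s.piece.ins + s.piece.outs) ◃ ofWord K (double t) ◃
        projBlock d 0 n := by
  set M := m - s.piece.ins + s.piece.outs with hM
  have h' : ∀ j < M, ∃ z : ℕ × ℕ, SameEdge [s, t] (1, j) z ∧ (z.1 = 0 ∨ z.1 = 2 ∨ z ∈ T) := by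
    intro j hj
    obtain ⟨j', h₁, h₂ | h₂⟩ := h j hj
    · obtain ⟨z, h₃, h₄⟩ := h₂.exists_sameEdge
      exact ⟨z, .trans _ _ _ h₁ h₃, h₄.elim Or.inl fun h => Or.inr (Or.inl h)⟩
    · exact ⟨_, h₁, Or.inr (Or.inr h₂)⟩
  choose! f hf hf' using h'
  have hn : M - t.piece.ins + t.piece.outs = n := hw.2.2
  -- Adding the chosen points `f j` avoids bounding them: those on levels `0` and `2` are in the
  -- full rows or out of range, and those on level `1` are in `T`.
  let E : Finset (ℕ × ℕ) := ({0} ×ˢ Finset.range m) ∪ ({2} ×ˢ Finset.range n) ∪ T ∪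
    (Finset.range M).image f
  have key := hx.cable_union hw (E := E) (E' := {1} ×ˢ Finset.range M) (by
    rintro ⟨i, j⟩ hy
    simp only [Finset.mem_product, Finset.mem_singleton, Finset.mem_range] at hy
    obtain ⟨rfl, hj⟩ := hy
    exact ⟨f j, Finset.mem_union_right _
      (Finset.mem_image_of_mem _ (Finset.mem_range.2 hj)), hf j hj⟩)
  rw [cable, cable, cable, cable, cable, cable, zero_add, one_add_one_eq_two, ← hM, hn,
    projectors_eq_projBlock (i := 0), projectors_eq_projBlock (i := 1),
    projectors_eq_projBlock (i := 2), projectors_eq_projBlock (i := 0) (E := E),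
    projectors_eq_projBlock (i := 2) (E := E), projectors_congr (i := 1) (E' := T)] at key
  · rw [fullCable, fullCable, fullCable, ← hM, hn, key]
    simp only [act_mul]
  · intro j hj
    simp only [E, Finset.mem_union, Finset.mem_product, Finset.mem_singleton, Finset.mem_image,
      Finset.mem_range]
    constructor
    · rintro (((h | h) | h) | ⟨r, hr, h⟩)
      · omega
      · omega
      · exact h
      · rcases hf' r hr with h₁ | h₁ | h₁
        · rw [h] at h₁; simp at h₁
        · rw [h] at h₁; simp at h₁
        · rwa [h] at h₁
    · exact fun h => Or.inl (Or.inr h)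
  all_goals
    intro j hj
    simp [E, hj]

theorem Wide.fullCable_pair_of_passes {x : State d N} {s t : Slice} {m n : ℕ}
    (hx : Wide x (2 * m)) (hw : Runs m [s, t] n)
    (h : ∀ j < m - s.piece.ins + s.piece.outs, ∃ j', SameEdge [s, t] (1, j) (1, j') ∧
      Passes s t j') :
    x ◃ fullCable d m [s, t] =
      x ◃ projBlock d 0 m ◃ ofWord K (double s) ◃ ofWord K (double t) ◃ projBlock d 0 n := by
  rw [hx.fullCable_pair hw ∅
    fun j hj => (h j hj).imp fun _ h => ⟨h.1, Or.inl h.2⟩,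
    projectors_eq_one (by simp), act_one]

theorem act_fullCable_singleton (x : State d N) {s : Slice} {m n : ℕ} (hw : Runs m [s] n) :
    x ◃ fullCable d m [s] = x ◃ projBlock d 0 m ◃ ofWord K (double s) ◃ projBlock d 0 n := by
  rw [act_fullCable_cons, fullCable, show m - s.piece.ins + s.piece.outs = n from hw.2]

/-- The two strands joined by the minimum lie on one edge, so it is enough that one of them passes
the upper slice. -/
theorem exists_sameEdge_of_cup {s : Slice} {b j : ℕ} (h : Passes s ⟨b, .cup⟩ j ∨
    j = b ∧ Passes s ⟨b, .cup⟩ (b + 1) ∨ j = b + 1 ∧ Passes s ⟨b, .cup⟩ b) :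
    ∃ j', SameEdge [s, ⟨b, .cup⟩] (1, j) (1, j') ∧ Passes s ⟨b, .cup⟩ j' := by
  have hb : SameEdge [s, ⟨b, .cup⟩] (1, b) (1, b + 1) := .rel _ _ (.cup 1 b rfl)
  rcases h with h | ⟨rfl, h⟩ | ⟨rfl, h⟩
  · exact ⟨j, .refl _, h⟩
  · exact ⟨_, hb, h⟩
  · exact ⟨_, .symm _ _ hb, h⟩

/-! ### Doubled vertices -/

/-- The upper half of a doubled vertex with `p` legs going up. -/
def legsUp (b : ℕ) : ℕ → List Slice
  | 0 => [⟨b, .cap⟩]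
  | p + 1 => List.replicate p ⟨b + 1, .cup⟩

/-- The lower half of a doubled vertex with `q` legs going down. -/
def legsDown (b : ℕ) : ℕ → List Slice
  | 0 => [⟨b, .cup⟩]
  | q + 1 => List.replicate q ⟨b + 1, .cap⟩

theorem act_double_vertex (x : State d N) (a p q : ℕ) :
    x ◃ ofWord K (double ⟨a, .vertex p q⟩) =
      x ◃ ofWord K (legsUp (2 * a) p) ◃ ofWord K (legsDown (2 * a) q) := by
  rw [← act_mul, ← ofWord_append]
  cases p <;> cases q <;> rfl

theorem act_replicate_succ (x : State d N) (s : Slice) (k : ℕ) :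
    x ◃ ofWord K (List.replicate (k + 1) s) =
      x ◃ ofWord K [s] ◃ ofWord K (List.replicate k s) := by
  rw [List.replicate_succ, ofWord_cons, act_mul]

theorem act_replicate_succ' (x : State d N) (s : Slice) (k : ℕ) :
    x ◃ ofWord K (List.replicate (k + 1) s) =
      x ◃ ofWord K (List.replicate k s) ◃ ofWord K [s] := by
  rw [List.replicate_succ', ofWord_append, act_mul]

theorem caps_cup_left (x : State d N) {c e : ℕ} (h : c ≤ e) (q : ℕ) :
    x ◃ caps[c, q] ◃ cup[e + 2 * q] = x ◃ cup[e] ◃ caps[c, q] := by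
  induction q generalizing x with
  | zero => simp [ofWord_nil]
  | succ q ih =>
    rw [act_replicate_succ', mul_add_one, ← add_assoc, cap_cup _ (by omega), ih,
      act_replicate_succ']

theorem caps_cup_right (x : State d N) {c e : ℕ} (h : e ≤ c) (q : ℕ) :
    x ◃ caps[c + 2, q] ◃ cup[e] = x ◃ cup[e] ◃ caps[c, q] := by
  induction q generalizing x with
  | zero => simp [ofWord_nil]
  | succ q ih => rw [act_replicate_succ', ← cup_cap _ h, ih, act_replicate_succ']

theorem cups_cup (x : State d N) {c e : ℕ} (h : e ≤ c) (p : ℕ) :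
    x ◃ cups[c + 2, p] ◃ cup[e] = x ◃ cup[e] ◃ cups[c, p] := by
  induction p generalizing x with
  | zero => simp [ofWord_nil]
  | succ p ih => rw [act_replicate_succ', ← cup_cup _ h, ih, act_replicate_succ']

theorem Wide.caps {x : State d N} {k : ℕ} (hx : Wide x k) (a q : ℕ) : Wide (x ◃ caps[a, q]) k := by
  induction q with
  | zero => simpa [ofWord_nil] using hx
  | succ q ih => rw [act_replicate_succ']; exact (ih.cap a).mono (Nat.le_add_right _ _)

/-- The minimum joins the right side of the vertex to the next doubled leg, which becomes its
rightmost upper leg. For `p = 0` this is a zigzag, since a vertex without upper legs begins with a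
maximum. -/
theorem Wide.legsUp_cup {x : State d N} {k b p : ℕ} (hx : Wide x k) (h : b + 1 ≤ k) :
    x ◃ ofWord K (legsUp b p) ◃ cup[b + 1] = x ◃ ofWord K (legsUp b (p + 1)) := by
  cases p with
  | zero => rw [legsUp, legsUp, hx.zigzag_left h, List.replicate_zero, ofWord_nil, act_one]
  | succ p => exact (act_replicate_succ' _ _ _).symm

theorem Wide.cup_legsUp {x : State d N} {k b p : ℕ} (hx : Wide x k) (h : b + 2 ≤ k) :
    x ◃ ofWord K (legsUp (b + 2) p) ◃ cup[b + 1] = x ◃ ofWord K (legsUp b (p + 1)) := by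
  cases p with
  | zero => rw [legsUp, legsUp, hx.zigzag_right h, List.replicate_zero, ofWord_nil, act_one]
  | succ p =>
    rw [legsUp, legsUp, add_right_comm, cups_cup x le_rfl, act_replicate_succ]

/-- Turning up the last lower leg turns one of the maxima between the legs into part of a zigzag;
what remains is the minimum that attaches a new upper leg. -/
theorem Wide.legsDown_cup {x : State d N} {k b q : ℕ} (hx : Wide x k) (h : b + 4 ≤ k) :
    x ◃ ofWord K (legsDown b (q + 1)) ◃ cup[b + 2 * q + 1] ◃ cup[b + 2 * q] =
      x ◃ cup[b + 1] ◃ ofWord K (legsDown b q) := by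
  rw [legsDown, add_right_comm, caps_cup_left x le_rfl]
  cases q with
  | zero => simp [ofWord_nil, legsDown]
  | succ q =>
    rw [legsDown, act_replicate_succ, show b + 2 * (q + 1) = b + 2 + 2 * q by ring,
      caps_cup_left _ (by omega), (hx.cup _).zigzag_left (by omega)]

theorem Wide.cup_legsDown {x : State d N} {k b q : ℕ} (hx : Wide x k) (h : b + 4 ≤ k) :
    x ◃ ofWord K (legsDown (b + 2) (q + 1)) ◃ cup[b + 1] ◃ cup[b] =
      x ◃ cup[b + 1] ◃ ofWord K (legsDown b q) := by
  rw [legsDown, add_right_comm b 2 1, caps_cup_right x le_rfl]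
  cases q with
  | zero => simp [ofWord_nil, legsDown]
  | succ q => rw [legsDown, act_replicate_succ', ((hx.cup _).caps _ _).zigzag_right (by omega)]

theorem runs_legsUp {k b p : ℕ} (h : b + 2 * p ≤ k) :
    Runs k (legsUp b p) (k - 2 * p + 2) := by
  cases p with
  | zero => exact ⟨h, rfl⟩
  | succ p =>
    have := Runs.replicate_cup (b + 1) (k - (b + 1) - 2 * p - 1) p
    rw [legsUp]
    convert this using 1 <;> omega

/-! ### Isotopy invariance -/

theorem Move.excess_eq {s t : List Slice} (h : Move s t) : excess s = excess t := by
  cases h <;> simp [excess, Piece.excess] <;> ring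

/-- In every event all edges at the middle level reach the top or bottom, so the middle projectors
can be dropped. What remains is an isotopy of doubled curves. -/
theorem Wide.fullCable_move {x : State d N} {s t : List Slice} {k l : ℕ} (hx : Wide x (2 * k))
    (h : Move s t) (hs : Runs k s l) (ht : Runs k t l) :
    x ◃ fullCable d k s = x ◃ fullCable d k t := by
  have hx' : Wide (x ◃ projBlock d 0 k) (2 * k) := hx.act_span (projBlock_mem_span k)
  cases h with
  | slide a c g h =>
    rw [hx.fullCable_pair_of_passes hs, hx.fullCable_pair_of_passes ht]
    · congr 1
      rw [ofWord_double ⟨a, g⟩, ofWord_double ⟨_, h⟩, ofWord_double ⟨a + g.ins + c, h⟩]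
      exact act_interchange _ (double_mem_span g) (curveWords_le_arcSpan (double_mem_span h))
        (by dsimp only; omega) (by dsimp only; omega)
    all_goals
      refine fun j _ => ⟨j, .refl _, ?_⟩
      dsimp only [Passes]
      omega
  | straighten_left a =>
    have h₁ : a + 1 + 2 ≤ k - 0 + 2 := hs.2.1
    obtain rfl : k = l := ht
    -- Exchanging the inner maximum with the minimum below it leaves two successive zigzags.
    rw [hx.fullCable_pair_of_passes hs, act_double_cap, act_double_cup, mul_add_one,
      cap_cup _ le_rfl, hx'.zigzag_left (by omega), hx'.zigzag_left (by omega), projBlock_idem, fullCable]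
    intro j _
    refine exists_sameEdge_of_cup ?_
    dsimp only [Passes, Piece.ins, Piece.outs]
    omega
  | straighten_right a =>
    have h₁ : a + 2 ≤ k - 0 + 2 := hs.2.1
    have h₂ : a + 1 + 0 ≤ k := hs.1
    obtain rfl : k = l := ht
    rw [hx.fullCable_pair_of_passes hs, act_double_cap, act_double_cup, mul_add_one,
      show 2 * a + 2 + 1 = 2 * a + 1 + 2 from rfl, ← cup_cap _ le_rfl,
      hx'.zigzag_right (by omega), hx'.zigzag_right (by omega), projBlock_idem, fullCable]
    intro j _
    refine exists_sameEdge_of_cup ?_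
    dsimp only [Passes, Piece.ins, Piece.outs]
    omega
  | bend_right a p q =>
    have h₁ : a + (p + 1) ≤ k := ht.1
    have h₂ := hx'.act_word (runs_legsUp (b := 2 * a) (p := p) (k := 2 * k) (by omega))
    rw [hx.fullCable_pair_of_passes hs, act_fullCable_singleton _ ht, act_double_vertex,
      act_double_vertex, act_double_cup, mul_add, h₂.legsDown_cup (by omega),
      hx'.legsUp_cup (by omega)]
    intro j _
    refine exists_sameEdge_of_cup ?_
    dsimp only [Passes, Piece.ins, Piece.outs]
    omega
  | bend_left a p q =>
    have h₁ : a + (p + 1) ≤ k := ht.1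
    have h₂ := hx'.act_word (runs_legsUp (b := 2 * a + 2) (p := p) (k := 2 * k) (by omega))
    rw [hx.fullCable_pair_of_passes hs, act_fullCable_singleton _ ht, act_double_vertex,
      act_double_vertex, act_double_cup, mul_add_one, h₂.cup_legsDown (by omega),
      hx'.cup_legsUp (by omega)]
    intro j _
    refine exists_sameEdge_of_cup ?_
    dsimp only [Passes, Piece.ins, Piece.outs]
    omega

/-! ### Contraction and deletion, and univalent vertices -/

theorem act_projectors_singleton (x : State d N) {i j m : ℕ} (h : j < m) :
    x ◃ projectors d {(i, j)} i m = x ◃ projector d j := by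
  have := act_projectors_insert x ∅ (i := i) h
  rwa [projectors_eq_one (E := ∅) (by simp), act_one] at this

/-- Only the edge between the two vertices needs a projector. A single leg contributes no slices to
a doubled vertex, so the identity term is literally the merged vertex; the minimum and maximum of
the turnback are the ends of vertices without lower and upper legs. -/
theorem Wide.fullCable_contraction_deletion {x : State d N} {a p q k l : ℕ}
    (hx : Wide x (2 * k)) (h : Runs k [⟨a, .vertex p 1⟩, ⟨a, .vertex 1 q⟩] l)
    (h₁ : Runs k [⟨a, .vertex p q⟩] l) (h₂ : Runs k [⟨a, .vertex p 0⟩, ⟨a, .vertex 0 q⟩] l) :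
    x ◃ fullCable d k [⟨a, .vertex p 1⟩, ⟨a, .vertex 1 q⟩] =
      x ◃ fullCable d k [⟨a, .vertex p q⟩] -
        ((d⁻¹ : Kˣ) : K) • (x ◃ fullCable d k [⟨a, .vertex p 0⟩, ⟨a, .vertex 0 q⟩]) := by
  have h₃ : a + 1 ≤ k - p + 1 := h.2.1
  rw [hx.fullCable_pair h {(1, a)}, act_fullCable_singleton _ h₁,
    hx.fullCable_pair_of_passes h₂, act_projectors_singleton]
  · simp only [act_double_vertex, act_projector, sub_act, smul_act]
    simp [legsUp, legsDown, ofWord_nil]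
  · exact h₃
  · refine fun j _ => ⟨j, .refl _, ?_⟩
    dsimp only [Passes, Piece.ins, Piece.outs]
    omega
  · refine fun j _ => ⟨j, .refl _, ?_⟩
    simp only [Passes, Piece.ins, Piece.outs, Finset.mem_singleton, Prod.mk.injEq, true_and]
    omega

theorem Wide.fullCable_univalent {x : State d N} {a k l : ℕ}
    (hx : Wide x (2 * k)) (h : Runs k [⟨a, .vertex 0 1⟩] l) :
    x ◃ fullCable d k [⟨a, .vertex 0 1⟩] = 0 := by
  have hx' : Wide (x ◃ projBlock d 0 k) (2 * k) := hx.act_span (projBlock_mem_span k)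
  have ha : a + 0 ≤ k := h.1
  obtain rfl : k + 1 = l := h.2
  rw [act_fullCable_singleton x h, ← projBlock_absorb _ (b := a) (k := 1) (Nat.zero_le _) (by omega),
    ← projBlock_comm, projBlock_one, act_double_vertex, act_projector]
  simp only [legsUp, legsDown, List.replicate_zero, ofWord_nil, act_one]
  rw [hx'.loop (by omega)]
  simp [smul_smul]

/-! ### Evaluation of pictures without endpoints at the bottom -/

/-- A local maximum on top of a word of local minima is a multiple of a word of local minima. -/
theorem exists_cups_of_cap_cups (d : Kˣ) (N : ℕ) {w : List Slice} {k b : ℕ}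
    (hw : ∀ s ∈ w, s.piece = .cup) (hr : Runs (k + 2) w 0) (hb : b ≤ k) :
    ∃ (c : K) (v : List Slice), (∀ s ∈ v, s.piece = .cup) ∧ Runs k v 0 ∧
      ∀ (x : State d N) (a j : ℕ), Wide x j → a + k ≤ j →
        x ◃ cap[a + b] ◃ ofWord K (shift a w) = c • (x ◃ ofWord K (shift a v)) := by
  induction w generalizing k b with
  | nil => exact absurd hr (by simp [Runs])
  | cons s w ih =>
    obtain ⟨e, g⟩ := s
    obtain ⟨rfl, hw'⟩ := List.forall_mem_cons.1 hw
    have he : e + 2 ≤ k + 2 := hr.1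
    have hr' : Runs k w 0 := hr.2
    have hcons : ∀ a e, ofWord K (shift a (⟨e, .cup⟩ :: w)) = cup[a + e] * ofWord K (shift a w) :=
      fun a e => ofWord_cons _ _
    -- The maximum against the first minimum: at the same position they close a circle, at
    -- neighbouring positions they form a zigzag, and otherwise they exchange heights and the
    -- induction continues.
    rcases (by omega : e = b ∨ e = b + 1 ∨ b = e + 1 ∨ b + 2 ≤ e ∨ e + 2 ≤ b) with
      rfl | rfl | rfl | hf | hf
    · exact ⟨d, w, hw', hr', fun x a j hx hj => by
        rw [hcons, act_mul, hx.loop (by omega), smul_act]⟩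
    · exact ⟨1, w, hw', hr', fun x a j hx hj => by
        rw [hcons, act_mul, ← add_assoc, hx.zigzag_left (by omega), one_smul]⟩
    · exact ⟨1, w, hw', hr', fun x a j hx hj => by
        rw [hcons, act_mul, ← add_assoc, hx.zigzag_right (by omega), one_smul]⟩
    · obtain ⟨f, rfl⟩ : ∃ f, e = f + 2 := ⟨e - 2, by omega⟩
      obtain ⟨c, v, hv, hv', h⟩ := ih (k := k - 2) (b := b) hw'
        (by rwa [show k - 2 + 2 = k by omega]) (by omega)
      refine ⟨c, ⟨f, .cup⟩ :: v, List.forall_mem_cons.2 ⟨rfl, hv⟩,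
        ⟨by simp only [Piece.ins]; omega, hv'⟩, fun x a j hx hj => ?_⟩
      rw [hcons, act_mul, ← add_assoc, cap_cup _ (by omega),
        h _ a (j - 2) (hx.cup _) (by omega), ← act_mul]
      exact congrArg (fun y => c • (x ◃ y)) (ofWord_cons _ _).symm
    · obtain ⟨f, rfl⟩ : ∃ f, b = f + 2 := ⟨b - 2, by omega⟩
      obtain ⟨c, v, hv, hv', h⟩ := ih (k := k - 2) (b := f) hw'
        (by rwa [show k - 2 + 2 = k by omega]) (by omega)
      refine ⟨c, ⟨e, .cup⟩ :: v, List.forall_mem_cons.2 ⟨rfl, hv⟩,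
        ⟨by simp only [Piece.ins]; omega, hv'⟩, fun x a j hx hj => ?_⟩
      rw [hcons, act_mul, ← add_assoc, ← cup_cap _ (by omega),
        h _ a (j - 2) (hx.cup _) (by omega), ← act_mul]
      exact congrArg (fun y => c • (x ◃ y)) (ofWord_cons _ _).symm

/-- A word without endpoints at the bottom is a multiple of a word of local minima. -/
theorem exists_cups (d : Kˣ) (N : ℕ) {w : List Slice} {k : ℕ}
    (hw : ∀ s ∈ w, s.piece.IsArc) (hr : Runs k w 0) :
    ∃ (c : K) (v : List Slice), (∀ s ∈ v, s.piece = .cup) ∧ Runs k v 0 ∧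
      ∀ (x : State d N) (a j : ℕ), Wide x j → a + k ≤ j →
        x ◃ ofWord K (shift a w) = c • (x ◃ ofWord K (shift a v)) := by
  induction w generalizing k with
  | nil => exact ⟨1, [], by simp, hr, fun x a j _ _ => by rw [one_smul]⟩
  | cons s w ih =>
    obtain ⟨e, g⟩ := s
    obtain ⟨hg, hw'⟩ := List.forall_mem_cons.1 hw
    obtain ⟨c, v, hv, hv', h⟩ := ih hw' hr.2
    have hcons : ∀ a, ofWord K (shift a (⟨e, g⟩ :: w)) =
      ofWord K [⟨a + e, g⟩] * ofWord K (shift a w) := fun a => ofWord_cons _ _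
    have he := hr.1
    cases g with
    | cap =>
      obtain ⟨c', u, hu, hu', h'⟩ := exists_cups_of_cap_cups d N (k := k) (b := e) hv hv' he
      refine ⟨c * c', u, hu, hu', fun x a j hx hj => ?_⟩
      rw [hcons, act_mul, h _ a (j + 2) (hx.cap _) (by simp only [Piece.ins, Piece.outs]; omega),
        h' x a j hx hj, mul_smul]
    | cup =>
      simp only [Piece.ins] at he
      refine ⟨c, ⟨e, .cup⟩ :: v, List.forall_mem_cons.2 ⟨rfl, hv⟩, ⟨he, hv'⟩,
        fun x a j hx hj => ?_⟩
      rw [hcons, act_mul, h _ a (j - 2) (hx.cup _) (by simp only [Piece.ins, Piece.outs]; omega),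
        ← act_mul]
      exact congrArg (fun y => c • (x ◃ y)) (ofWord_cons _ _).symm
    | vertex p q => exact hg.elim

/-- A word of minima without endpoints is empty. The scalar is independent of `x` and `a`, so the
contents of a circle have the same value before and after its removal. -/
theorem exists_scalar (d : Kˣ) (N : ℕ) {f : WordAlgebra K}
    (hf : f ∈ Submodule.span K (curveWords K 0 0)) :
    ∃ c : K, ∀ (x : State d N) (a j : ℕ), Wide x j → a ≤ j → x ◃ shiftHom K a f = c • x := by
  induction hf using Submodule.span_induction with
  | mem f hf =>
    obtain ⟨w, hr, hw, rfl⟩ := hf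
    obtain ⟨c, v, hv, hv', h⟩ := exists_cups d N hw hr
    refine ⟨c, fun x a j hx hj => ?_⟩
    rw [shiftHom_ofWord, h x a j hx hj]
    cases v with
    | nil => simp [shift, ofWord_nil]
    | cons s v =>
      have h₁ := hv'.1
      rw [hv s List.mem_cons_self] at h₁
      simp [Piece.ins] at h₁
  | zero => exact ⟨0, fun x a j _ _ => by simp⟩
  | add f g _ _ hf hg =>
    obtain ⟨c, h⟩ := hf
    obtain ⟨c', h'⟩ := hg
    exact ⟨c + c', fun x a j hx hj => by
      rw [map_add, act_add, h x a j hx hj, h' x a j hx hj, add_smul]⟩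
  | smul r f _ hf =>
    obtain ⟨c, h⟩ := hf
    exact ⟨r * c, fun x a j hx hj => by rw [map_smul, act_smul, h x a j hx hj, mul_smul]⟩

/-- A word of minima on two strands is a single minimum. This evaluates the part inside a loop
together with the legs attaching it to the vertex. -/
theorem exists_scalar_cup (d : Kˣ) (N : ℕ) {f : WordAlgebra K}
    (hf : f ∈ Submodule.span K (curveWords K 2 0)) :
    ∃ c : K, ∀ (x : State d N) (a j : ℕ), Wide x j → a + 2 ≤ j →
      x ◃ shiftHom K a f = c • (x ◃ cup[a]) := by
  induction hf using Submodule.span_induction with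
  | mem f hf =>
    obtain ⟨w, hr, hw, rfl⟩ := hf
    obtain ⟨c, v, hv, hv', h⟩ := exists_cups d N hw hr
    refine ⟨c, fun x a j hx hj => ?_⟩
    rw [shiftHom_ofWord, h x a j hx hj]
    obtain _ | ⟨⟨e, g⟩, v⟩ := v
    · simp [Runs] at hv'
    · obtain ⟨hg, hv₂⟩ := List.forall_mem_cons.1 hv
      obtain rfl : g = .cup := hg
      have h₁ : e + 2 ≤ 2 := hv'.1
      obtain rfl : e = 0 := by omega
      obtain _ | ⟨⟨e, g⟩, v⟩ := v
      · rfl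
      · obtain rfl : g = .cup := (List.forall_mem_cons.1 hv₂).1
        have h₂ := hv'.2.1
        simp [Piece.ins, Piece.outs] at h₂
  | zero => exact ⟨0, fun x a j _ _ => by simp⟩
  | add f g _ _ hf hg =>
    obtain ⟨c, h⟩ := hf
    obtain ⟨c', h'⟩ := hg
    exact ⟨c + c', fun x a j hx hj => by
      rw [map_add, act_add, h x a j hx hj, h' x a j hx hj, add_smul]⟩
  | smul r f _ hf =>
    obtain ⟨c, h⟩ := hf
    exact ⟨r * c, fun x a j hx hj => by rw [map_smul, act_smul, h x a j hx hj, mul_smul]⟩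

/-! ### Translated drawings -/

theorem Wide.act_proj {x : State d N} {k j : ℕ} (hx : Wide x k) (h : 2 * j + 2 ≤ k) :
    Wide (x ◃ projector d j) k := by
  rw [act_projector]
  exact Submodule.sub_mem _ hx
    (Submodule.smul_mem _ _ (((hx.cup _).cap _).mono (Nat.sub_add_cancel (le_of_add_le_right h)).ge))

theorem shiftHom_mem_span {f : WordAlgebra K} {k l : ℕ}
    (hf : f ∈ Submodule.span K (curveWords K k l)) (a b : ℕ) :
    shiftHom K a f ∈ Submodule.span K (curveWords K (a + k + b) (a + l + b)) := by
  induction hf using Submodule.span_induction with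
  | mem f hf =>
    obtain ⟨w, hr, hw, rfl⟩ := hf
    exact Submodule.subset_span ⟨_, hr.shift a b, arc_shift hw, shiftHom_ofWord a w⟩
  | zero => rw [map_zero]; exact Submodule.zero_mem _
  | add f g _ _ hf hg => rw [map_add]; exact Submodule.add_mem _ hf hg
  | smul c f _ hf => rw [map_smul]; exact Submodule.smul_mem _ _ hf

theorem act_projBlock_split (x : State d N) (a k b : ℕ) :
    x ◃ projBlock d 0 (a + k + b) =
      x ◃ projBlock d 0 a ◃ projBlock d (a + k) b ◃ projBlock d a k := by
  rw [projBlock_add, projBlock_add, act_mul, act_mul, zero_add, zero_add, projBlock_comm]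

/-- The projectors on the `a` strands to the left and the `b` strands to the right slide up past the
picture and merge into one row on each side. -/
theorem act_fullCable_shift (x : State d N) {X : List Slice} {k l : ℕ} (hX : Runs k X l)
    (a b : ℕ) :
    x ◃ fullCable d (a + k + b) (shift a X) =
      x ◃ projBlock d 0 a ◃ projBlock d (a + k) b ◃ shiftHom K (2 * a) (fullCable d k X) := by
  induction X generalizing x k with
  | nil =>
    simp only [shift, List.map_nil, fullCable]
    rw [shiftHom_projBlock, add_zero, act_projBlock_split]
  | cons s X ih =>
    have hs := hX.1
    have h₁ : shift a (s :: X) = ⟨a + s.left, s.piece⟩ :: shift a X := rfl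
    rw [h₁, act_fullCable_cons]
    dsimp only
    rw [show a + k + b - s.piece.ins + s.piece.outs = a + (k - s.piece.ins + s.piece.outs) + b by
      omega, ih _ hX.2, projBlock_pass_left _ (by dsimp only; omega),
      projBlock_absorb _ (Nat.zero_le _) (by omega),
      projBlock_pass_right (a := a + k) _ _ (by dsimp only; omega) (by dsimp only; omega),
      projBlock_absorb _ (Nat.zero_le _) (by omega), fullCable, map_mul, map_mul,
      act_mul, act_mul, act_projBlock_split, shiftHom_projBlock, add_zero, shiftHom_ofWord,
      double_eq_shift ⟨a + s.left, _⟩, double_eq_shift s, shift_shift, mul_add]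

/-! ### Circles and loops -/

theorem Wide.fullCable_circle {x : State d N} {X : List Slice} {a k : ℕ} (hx : Wide x (2 * k))
    (hX : Runs 0 X 0) (ha : a ≤ k) :
    x ◃ fullCable d k ([⟨a, .cap⟩] ++ shift (a + 1) X ++ [⟨a, .cup⟩]) =
      ((d : K) ^ 2 - 1) • (x ◃ fullCable d k (shift a X)) := by
  have hx' : Wide (x ◃ projBlock d 0 k) (2 * k) := hx.act_span (projBlock_mem_span k)
  obtain ⟨b, rfl⟩ := Nat.exists_eq_add_of_le ha
  have hF : fullCable d 0 X ∈ Submodule.span K (curveWords K 0 0) :=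
    fullCable_mem_span (m := 0) (n := 0) hX
  obtain ⟨c, hc⟩ := exists_scalar d N hF
  have h₁ : Runs (a + b) [⟨a, .cap⟩] (a + b + 2) := ⟨ha, rfl⟩
  have h₂ : Runs (a + b + 2) (shift (a + 1) X) (a + b + 2) := by
    convert hX.shift (a + 1) (1 + b) using 1 <;> omega
  have h₃ : Runs (a + b) [⟨a, .cap⟩, ⟨a, .cup⟩] (a + b) :=
    ⟨ha, by simp only [Piece.ins, Piece.outs]; omega, rfl⟩
  have h₄ : x ◃ fullCable d (a + b) (shift a X) = c • (x ◃ projBlock d 0 (a + b)) := by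
    have := act_fullCable_shift x (d := d) hX a b
    rw [add_zero] at this
    have hsplit : x ◃ projBlock d 0 (a + b) = x ◃ projBlock d 0 a ◃ projBlock d a b := by
      rw [projBlock_add, act_mul, zero_add]
    rw [this, ← hsplit]
    exact hc _ _ _ hx' (by omega)
  have h₅ : ∀ y : State d N, Wide y (2 * (a + b + 2)) →
      y ◃ projBlock d 0 (a + b + 2) ◃ fullCable d (a + b + 2) (shift (a + 1) X) =
        c • (y ◃ projBlock d 0 (a + b + 2)) := by
    intro y hy
    -- The interior has the left side of the circle among the `a + 1` strands to its left, and the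
    -- right side among the `1 + b` strands to its right.
    have := act_fullCable_shift (y ◃ projBlock d 0 (a + b + 2)) (d := d) hX (a + 1) (1 + b)
    rw [show a + 1 + 0 + (1 + b) = a + b + 2 by omega] at this
    rw [this, projBlock_absorb y (b := 0) (k := a + 1) le_rfl (by omega),
      projBlock_absorb y (Nat.zero_le _) (by omega)]
    exact hc _ _ (2 * (a + b + 2)) (hy.act_span (projBlock_mem_span _)) (by omega)
  have h₆ : x ◃ fullCable d (a + b) [⟨a, .cap⟩] ◃ fullCable d (a + b + 2) (shift (a + 1) X) =
      c • (x ◃ fullCable d (a + b) [⟨a, .cap⟩]) := by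
    have := h₅ _ (hx.act_span (fullCable_mem_span (d := d) h₁))
    rwa [fullCable_projBlock _ h₁] at this
  rw [fullCable_append _ (h₁.append h₂), fullCable_append _ h₁, h₆, smul_act,
    ← fullCable_append _ h₁, h₄, smul_comm]
  congr 1
  rw [List.singleton_append, hx.fullCable_pair h₃ {(1, a)}, act_projectors_singleton,
    act_projector]
  · simp only [sub_act, smul_act, act_double_cap, act_double_cup]
    rw [(hx'.cap _).loop (by omega), smul_act, hx'.loop (by omega),
      (hx'.cap _).zigzag_right (by omega), (hx'.cap _).zigzag_left (by omega),
      hx'.loop (by omega)]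
    simp only [smul_act, projBlock_idem, smul_smul, Units.inv_mul, ← sub_smul, pow_two]
  · simp only [Piece.ins, Piece.outs]; omega
  · intro j _
    -- The two sides of the circle lie on one edge, which never leaves the middle level; its
    -- projector sits on strand `a`.
    by_cases hj : j = a + 1
    · refine ⟨a, ?_, Or.inr (Finset.mem_singleton_self _)⟩
      subst hj
      exact .symm _ _ (.rel _ _ (.cap 0 a rfl))
    · refine ⟨j, .refl _, ?_⟩
      simp only [Passes, Piece.ins, Piece.outs, Finset.mem_singleton, Prod.mk.injEq, true_and]
      omega

theorem legsDown_eq_shift (b k : ℕ) : legsDown b k = shift b (legsDown 0 k) := by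
  cases k <;> simp [legsDown, shift]

theorem legsDown_mem_span (k : ℕ) :
    ofWord K (legsDown 0 k) ∈ Submodule.span K (curveWords K 2 (2 * k)) := by
  refine Submodule.subset_span ⟨_, ?_, ?_, rfl⟩
  · cases k with
    | zero => exact ⟨le_rfl, rfl⟩
    | succ k =>
      have := Runs.replicate_cap 1 1 k
      rw [legsDown]
      convert this using 1
      omega
  · cases k <;> simp +contextual [legsDown, Piece.IsArc, List.mem_replicate]

theorem cap_caps (x : State d N) (c j : ℕ) :
    x ◃ cap[c] ◃ caps[c, j] = x ◃ cap[c] ◃ caps[c + 2, j] := by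
  induction j generalizing x with
  | zero => simp [ofWord_nil]
  | succ j ih => rw [act_replicate_succ, act_replicate_succ, ih, cap_cap _ le_rfl,
      ← cap_cap x le_rfl]

/-- Three doubled legs, the middle one of which is split into `k`: the outer two form the loop and
the middle ones lead into its interior. -/
theorem Wide.legsDown_add_two {x : State d N} {b k j : ℕ} (hx : Wide x j) (h : b ≤ j) :
    x ◃ ofWord K (legsDown b (k + 2)) =
      x ◃ cap[b + 1] ◃ cap[b + 1] ◃ ofWord K (legsDown (b + 2) k) := by
  rw [legsDown]
  cases k with
  | zero =>
    rw [legsDown, List.replicate_one]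
    exact ((hx.cap _).zigzag_left (by omega)).symm
  | succ k => rw [act_replicate_succ, act_replicate_succ, cap_caps, legsDown, add_right_comm b 2 1]

/-- With the interior reduced to `cup[2 * a + 2]`, the identity term of the projector closes one
circle and the turnback term none. -/
theorem Wide.loop_resolution {x : State d N} {a j : ℕ} (hx : Wide x j) (h : 2 * a + 2 ≤ j) :
    x ◃ cap[2 * a + 1] ◃ cap[2 * a + 1] ◃ projector d a ◃ cup[2 * a + 2] ◃ cup[2 * a + 1] ◃
        cup[2 * a] = ((d : K) - ((d⁻¹ : Kˣ) : K)) • (x ◃ cup[2 * a]) := by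
  rw [act_projector]
  simp only [sub_act, smul_act]
  rw [(hx.cap _).zigzag_left (by omega), hx.loop (by omega), smul_act,
    (hx.cap _).zigzag_right (by omega), cap_cup _ le_rfl, hx.zigzag_right (by omega),
    hx.zigzag_left (by omega), sub_smul]

theorem projector_pass_shift (x : State d N) (a : ℕ) {b : ℕ} {f : WordAlgebra K} (hf : f ∈ arcSpan K)
    (h : 2 * a + 2 ≤ b) :
    x ◃ projector d a ◃ shiftHom K b f = x ◃ shiftHom K b f ◃ projector d a := by
  rw [projector_eq_shift]
  exact act_interchange x projector_mem_span hf h rfl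

theorem Wide.fullCable_loop {x : State d N} {X : List Slice} {a p b k : ℕ}
    (hx : Wide x (2 * (a + p + b))) (hX : Runs k X 0) :
    x ◃ fullCable d (a + p + b)
        ([⟨a, .vertex p (k + 2)⟩] ++ shift (a + 1) X ++ [⟨a, .cup⟩]) =
      ((d : K) - ((d⁻¹ : Kˣ) : K)) •
        (x ◃ fullCable d (a + p + b) ([⟨a, .vertex p k⟩] ++ shift a X)) := by
  set z := x ◃ projBlock d 0 (a + p + b) with hz
  have hzw : Wide z (2 * (a + p + b)) := hx.act_span (projBlock_mem_span _)
  set Y := fullCable d k X with hY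
  have hYs : Y ∈ Submodule.span K (curveWords K (2 * k) (2 * 0)) := fullCable_mem_span hX
  have hYa : Y ∈ arcSpan K := curveWords_le_arcSpan hYs
  have r₁ : Runs (a + p + b) [⟨a, .vertex p (k + 2)⟩] (a + 1 + k + (1 + b)) :=
    ⟨by simp only [Piece.ins]; omega, by simp only [Runs, Piece.ins, Piece.outs]; omega⟩
  have r₂ : Runs (a + 1 + k + (1 + b)) (shift (a + 1) X) (a + 2 + b) := by
    convert hX.shift (a + 1) (1 + b) using 1
    omega
  have r₃ : Runs (a + 2 + b) [⟨a, .cup⟩] (a + b) :=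
    ⟨by simp only [Piece.ins]; omega, by simp only [Runs, Piece.ins, Piece.outs]; omega⟩
  have r₁' : Runs (a + p + b) [⟨a, .vertex p k⟩] (a + k + b) :=
    ⟨by simp only [Piece.ins]; omega, by simp only [Runs, Piece.ins, Piece.outs]; omega⟩
  have r₂' : Runs (a + k + b) (shift a X) (a + b) := hX.shift a b
  -- Projectors on the strands beside the vertex slide up into the top row contained in `z`.
  have hl : ∀ q, z ◃ ofWord K (double ⟨a, .vertex p q⟩) ◃ projBlock d 0 a =
      z ◃ ofWord K (double ⟨a, .vertex p q⟩) := fun q => by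
    rw [projBlock_pass_left _ (by dsimp only; omega), hz,
      projBlock_absorb _ (Nat.zero_le _) (by omega)]
  have hr : ∀ q, z ◃ ofWord K (double ⟨a, .vertex p q⟩) ◃ projBlock d (a + q) b =
      z ◃ ofWord K (double ⟨a, .vertex p q⟩) := fun q => by
    rw [projBlock_pass_right (a := a + p) _ _ le_rfl (by simp only [Piece.ins, Piece.outs]; omega),
      hz, projBlock_absorb _ (Nat.zero_le _) (by omega)]
  have rhs : x ◃ fullCable d (a + p + b) ([⟨a, .vertex p k⟩] ++ shift a X) =
      z ◃ ofWord K (double ⟨a, .vertex p k⟩) ◃ shiftHom K (2 * a) Y := by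
    rw [fullCable_append _ r₁', act_fullCable_singleton _ r₁', projBlock_fullCable,
      act_fullCable_shift _ hX, ← hz, hl, hr]
  have lhs : x ◃ fullCable d (a + p + b)
      ([⟨a, .vertex p (k + 2)⟩] ++ shift (a + 1) X ++ [⟨a, .cup⟩]) =
      z ◃ ofWord K (double ⟨a, .vertex p (k + 2)⟩) ◃ projector d a ◃
        shiftHom K (2 * (a + 1)) Y ◃ ofWord K (double ⟨a, .cup⟩) ◃ projBlock d 0 (a + b) := by
    have hw : Wide (z ◃ ofWord K (double ⟨a, .vertex p (k + 2)⟩)) (2 * (a + 1 + k + (1 + b))) := by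
      have := hzw.act_double r₁.1
      rwa [show a + p + b - _ + _ = a + 1 + k + (1 + b) from r₁.2] at this
    have hpass : ∀ y : State d N, y ◃ projector d (a + 1 + k) ◃ shiftHom K (2 * (a + 1)) Y =
        y ◃ shiftHom K (2 * (a + 1)) Y ◃ projector d (a + 1) := fun y => by
      rw [projector_eq_shift (a + 1 + k), projector_eq_shift (a + 1)]
      exact (act_interchange y hYs projector_mem_arcSpan (by omega) (by omega)).symm
    rw [fullCable_append _ (r₁.append r₂), fullCable_append _ r₁, act_fullCable_singleton _ r₁,
      projBlock_fullCable, act_fullCable_singleton _ r₃, fullCable_projBlock _ r₂,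
      act_fullCable_shift _ hX, ← hz, ← hY]
    congr 1
    have hYs' := shiftHom_mem_span hYs (2 * (a + 1)) (2 * (1 + b))
    rw [show 2 * (a + 1) + 2 * k + 2 * (1 + b) = 2 * (a + 1 + k + (1 + b)) by ring] at hYs'
    have hw' := (hw.act_proj (j := a) (by omega)).act_span hYs'
    -- The loop has projectors on its first and last leg. The one on the last leg slides past the
    -- interior and around the minimum and is absorbed by the other.
    rw [projBlock_succ, act_mul, hl, zero_add, projBlock_add, act_mul, projBlock_one,
      projBlock_comm_projector, projBlock_comm_projector,
      show a + 1 + k + 1 = a + (k + 2) by omega, hr, hpass,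
      ← (hw'.mono (by omega)).projector_cup le_rfl, ← projector_pass_shift _ _ hYa (by omega),
      projector_idem]
  rw [← fullCable_projBlock x (r₁'.append r₂'), lhs, rhs, ← smul_act]
  congr 1
  rw [act_double_vertex, act_double_vertex, act_double_cup, mul_add_one]
  have hz' := hzw.act_word (runs_legsUp (b := 2 * a) (p := p) (by omega))
  obtain ⟨c, hc⟩ := exists_scalar_cup d N (mul_mem_span_curveWords (legsDown_mem_span k) hYs)
  have hS : ∀ (y : State d N) (r : ℕ), y ◃ ofWord K (legsDown r k) ◃ shiftHom K r Y =
      y ◃ shiftHom K r (ofWord K (legsDown 0 k) * Y) := fun y r => by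
    rw [map_mul, act_mul, shiftHom_ofWord, ← legsDown_eq_shift]
  rw [hS, hc _ _ _ hz' (by omega), hz'.legsDown_add_two (by omega), legsDown_eq_shift (2 * a + 2),
    ← shiftHom_ofWord,
    ← projector_pass_shift _ _ (curveWords_le_arcSpan (legsDown_mem_span k)) le_rfl,
    shiftHom_ofWord, ← legsDown_eq_shift, hS,
    hc _ _ _ (((hz'.cap _).cap _).act_proj (by omega)) (by omega)]
  simp only [smul_act]
  rw [hz'.loop_resolution (by omega), smul_comm]

/-! ### Local changes of drawings -/

/-- Every slice has its incoming strands available, so the truncated subtraction in `Runs` is exact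
and widths can also be read upwards. -/
theorem Runs.unique_left {w : List Slice} {k l m : ℕ} (h₁ : Runs k w m) (h₂ : Runs l w m) :
    k = l := by
  induction w generalizing k l with
  | nil => exact Eq.trans h₁ (Eq.symm h₂)
  | cons s w ih =>
    have h₃ := ih h₁.2 h₂.2
    have h₄ := h₁.1
    have h₅ := h₂.1
    omega

theorem excess_append (u v : List Slice) : excess (u ++ v) = excess u + excess v := by
  simp [excess]

theorem excess_shift (a : ℕ) (w : List Slice) : excess (shift a w) = excess w := by
  simp [excess, shift, Function.comp_def]

theorem exists_runs_of_word {n : ℕ} {G : Drawing n} {u s v : List Slice}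
    (h : G.word = u ++ s ++ v) : ∃ k l, Runs n u k ∧ Runs k s l ∧ Runs l v n := by
  have hG : Runs n G.word n := G.2
  rw [h] at hG
  obtain ⟨l, h₁, h₂⟩ := runs_append_iff.1 hG
  obtain ⟨k, h₃, h₄⟩ := runs_append_iff.1 h₁
  exact ⟨k, l, h₃, h₄, h₂⟩

theorem runs_replace {n k l : ℕ} {G : Drawing n} {u s v : List Slice}
    (h : G.word = u ++ s ++ v) (hu : Runs n u k) (hv : Runs l v n) : Runs k s l := by
  obtain ⟨k', l', h₁, h₂, h₃⟩ := exists_runs_of_word h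
  rwa [h₁.unique hu, h₃.unique_left hv] at h₂

theorem Drawing.toTLₗ_context {n k l : ℕ} {G : Drawing n} {u s v : List Slice}
    (h : G.word = u ++ s ++ v) (hu : Runs n u k) (hs : Runs k s l) :
    toTLₗ d (2 * n) (fullCable d n G.word) =
      toTLₗ d (2 * n) (fullCable d n u * fullCable d k s * fullCable d l v) := by
  refine toTLₗ_eq_of_act_eq ?_
  rw [h, fullCable_append _ (hu.append hs), fullCable_append _ hu, act_mul, act_mul]

theorem toTLₗ_fullCable_congr {n k l : ℕ} {u v : List Slice} {f g : WordAlgebra K}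
    (hu : Runs n u k) (h : ∀ x : State d (2 * n), Wide x (2 * k) → x ◃ f = x ◃ g) :
    toTLₗ d (2 * n) (fullCable d n u * f * fullCable d l v) =
      toTLₗ d (2 * n) (fullCable d n u * g * fullCable d l v) := by
  refine toTLₗ_eq_of_act_eq ?_
  rw [act_mul, act_mul, act_mul, act_mul,
    h _ ((wide_one (2 * n)).act_span (fullCable_mem_span hu))]

theorem Drawing.weight_eq_of_excess {n : ℕ} {G G' : Drawing n} (c : ℤ)
    (h : excess G.word = excess G'.word + c * 2) : G.weight d = d ^ c * G'.weight d := by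
  rw [Drawing.weight, Drawing.weight, h, Int.add_mul_ediv_right _ _ two_ne_zero, ← zpow_add,
    add_comm]

/-- Two drawings that agree outside of a disk inside of which they differ by a scalar factor. -/
theorem Drawing.image_eq_smul {n : ℕ} {G G' : Drawing n} {u s t v : List Slice}
    (hG : G.word = u ++ s ++ v) (hG' : G'.word = u ++ t ++ v) (c : ℤ) (r : K)
    (he : excess s = excess t + c * 2)
    (h : ∀ k l (x : State d (2 * n)), Wide x (2 * k) → Runs k s l → Runs k t l →
      x ◃ fullCable d k s = r • (x ◃ fullCable d k t)) :
    G.image d = (((d ^ c : Kˣ) : K) * r) • G'.image d := by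
  obtain ⟨k, l, hu, hs, hv⟩ := exists_runs_of_word hG
  have ht := runs_replace hG' hu hv
  rw [image, image, toTLₗ_context hG hu hs, toTLₗ_context hG' hu ht,
    toTLₗ_fullCable_congr (g := r • fullCable d k t) hu
      fun x hx => by rw [act_smul, h k l x hx hs ht],
    weight_eq_of_excess (G' := G') c]
  · rw [mul_smul_comm, smul_mul_assoc, map_smul, smul_smul, smul_smul, Units.val_mul]
    congr 1
    ring
  · rw [hG, hG']
    simp only [excess_append, he]
    ring

theorem Drawing.image_eq_of_step {n : ℕ} {G G' : Drawing n} (h : Step G G') :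
    G.image d = G'.image d := by
  obtain ⟨u, s, t, v, hm, hG, hG'⟩ := h
  rw [image_eq_smul hG hG' 0 1 (by rw [hm.excess_eq, zero_mul, add_zero])
    fun k l x hx hs ht => by rw [one_smul, hx.fullCable_move hm hs ht]]
  simp

/-! ### Multiplicativity and passage to isotopy classes. -/

theorem toTLₗ_mul {f g : WordAlgebra K} (hf : f ∈ Submodule.span K (curveWords K N N))
    (hg : g ∈ Submodule.span K (curveWords K N N)) :
    toTLₗ d N (f * g) = toTLₗ d N f * toTLₗ d N g := by
  induction hf using Submodule.span_induction with
  | mem f hf =>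
    obtain ⟨w₁, h₁, h₁', rfl⟩ := hf
    induction hg using Submodule.span_induction with
    | mem g hg =>
      obtain ⟨w₂, h₂, h₂', rfl⟩ := hg
      rw [← ofWord_append, toTLₗ_ofWord_of_runs d h₁ h₁', toTLₗ_ofWord_of_runs d h₂ h₂',
        toTLₗ_ofWord_of_runs d (h₁.append h₂)
          fun s hs => (List.mem_append.1 hs).elim (h₁' s) (h₂' s)]
      unfold curveClass curve
      rw [← map_mul, ← map_mul]
      rfl
    | zero => simp
    | add f g _ _ hf hg => simp only [mul_add, map_add, hf, hg]
    | smul c f _ hf => simp only [mul_smul_comm, map_smul, hf]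
  | zero => simp
  | add f g _ _ hf hg => simp only [add_mul, map_add, hf, hg]
  | smul c f _ hf => simp only [smul_mul_assoc, map_smul, hf]

theorem Drawing.weight_mul {n : ℕ} (G H : Drawing n) :
    (G * H).weight d = G.weight d * H.weight d := by
  have h : excess (G * H).word = excess G.word + excess H.word := excess_append _ _
  rw [weight, weight, weight, h, Int.add_ediv_of_dvd_left G.even_excess.two_dvd, zpow_add]

theorem Drawing.image_mul {n : ℕ} (G H : Drawing n) :
    (G * H).image d = G.image d * H.image d := by
  have h : toTLₗ d (2 * n) (fullCable d n (G * H).word) =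
      toTLₗ d (2 * n) (fullCable d n G.word * fullCable d n H.word) := by
    refine toTLₗ_eq_of_act_eq ?_
    rw [act_mul]
    exact fullCable_append _ G.2
  rw [image, image, image, h, toTLₗ_mul (fullCable_mem_span (w := G.word) G.2)
    (fullCable_mem_span (w := H.word) H.2),
    weight_mul, smul_mul_smul_comm, Units.val_mul]

/-- The map from drawings to the Temperley-Lieb algebra. -/
def drawingHom (d : Kˣ) (n : ℕ) : Drawing n →ₙ* TemperleyLieb K (d : K) (2 * n) where
  toFun := Drawing.image d
  map_mul' := Drawing.image_mul

theorem image_eq_of_isotopy {n : ℕ} {G H : Drawing n} (h : isotopy n G H) :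
    G.image d = H.image d := by
  -- The kernel of a multiplicative map is a congruence, so only the generating steps have to be
  -- checked.
  have : isotopy n ≤ Con.ker (drawingHom d n) :=
    Con.conGen_le.2 fun x y hxy => Drawing.image_eq_of_step hxy
  exact this h

/-- The map from isotopy classes of graphs to the Temperley-Lieb algebra. -/
def graphHom (d : Kˣ) (n : ℕ) : PlanarGraph n →ₙ* TemperleyLieb K (d : K) (2 * n) where
  toFun q := Con.liftOn q (Drawing.image d) fun _ _ => image_eq_of_isotopy
  map_mul' p q := by
    induction p, q using Con.induction_on₂ with
    | _ G H => exact Drawing.image_mul G H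

/-- The linear extension to the free algebra on isotopy classes of graphs. -/
def graphAlgebraHom (d : Kˣ) (n : ℕ) : GraphAlgebra K n →ₙₐ[K] TemperleyLieb K (d : K) (2 * n) :=
  MonoidAlgebra.liftMagma K (graphHom d n)

theorem graphAlgebraHom_graph {n : ℕ} (G : Drawing n) :
    graphAlgebraHom d n (graph K G) = G.image d := by
  unfold graphAlgebraHom graph
  rw [MonoidAlgebra.of_apply]
  simp [MonoidAlgebra.liftMagma_apply_apply]
  rfl

/-! ### The relations of the chromatic algebra -/

theorem graphAlgebraHom_rel {n : ℕ} {f g : GraphAlgebra K n}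
    (h : ChromaticRel K ((d : K) ^ 2) n f g) : graphAlgebraHom d n f = graphAlgebraHom d n g := by
  cases h with
  | contraction_deletion u v a p q G G₁ G₂ hG hG₁ hG₂ =>
    rw [map_sub, graphAlgebraHom_graph, graphAlgebraHom_graph, graphAlgebraHom_graph]
    obtain ⟨k, l, hu, hs, hv⟩ := exists_runs_of_word hG
    have hs₁ := runs_replace hG₁ hu hv
    have hs₂ := runs_replace hG₂ hu hv
    -- Contraction preserves the sum of `r - 2`; deletion lowers it by two, one for each end of the
    -- edge.
    have w₁ : G.weight d = d ^ (0 : ℤ) * G₁.weight d := by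
      refine Drawing.weight_eq_of_excess 0 ?_
      rw [hG, hG₁]
      simp [excess, Piece.excess]
      ring
    have w₂ : G.weight d = d ^ (1 : ℤ) * G₂.weight d := by
      refine Drawing.weight_eq_of_excess 1 ?_
      rw [hG, hG₂]
      simp [excess, Piece.excess]
      ring
    rw [zpow_zero, one_mul] at w₁
    rw [zpow_one] at w₂
    rw [Drawing.image, Drawing.image, Drawing.image, Drawing.toTLₗ_context hG hu hs,
      Drawing.toTLₗ_context hG₁ hu hs₁, Drawing.toTLₗ_context hG₂ hu hs₂,
      toTLₗ_fullCable_congr (g := fullCable d k [⟨a, .vertex p q⟩] -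
        ((d⁻¹ : Kˣ) : K) • fullCable d k [⟨a, .vertex p 0⟩, ⟨a, .vertex 0 q⟩]) hu
      fun x hx => by
        rw [act_sub, act_smul, hx.fullCable_contraction_deletion hs hs₁ hs₂]]
    rw [mul_sub, sub_mul, map_sub, mul_smul_comm, smul_mul_assoc, map_smul, smul_sub, smul_smul,
      w₁, ← w₁, w₂, mul_comm d, Units.val_mul, Units.mul_inv_cancel_right]
  | loop u X v a p k hX G G₁ hG hG₁ =>
    rw [map_smul, graphAlgebraHom_graph, graphAlgebraHom_graph]
    rw [Drawing.image_eq_smul (G := G) (G' := G₁) (u := u) (v := v)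
      (s := [⟨a, .vertex p (k + 2)⟩] ++ shift (a + 1) X ++ [⟨a, .cup⟩])
      (t := [⟨a, .vertex p k⟩] ++ shift a X) (by simpa using hG) (by simpa using hG₁) 1
      ((d : K) - ((d⁻¹ : Kˣ) : K))]
    · rw [zpow_one, mul_sub, Units.mul_inv, pow_two]
    · simp only [excess_append, excess_shift]
      simp [excess, Piece.excess]
      ring
    · intro m l x hx hs _
      have h₁ : a + p ≤ m := hs.1
      obtain ⟨b, rfl⟩ := Nat.exists_eq_add_of_le h₁
      exact hx.fullCable_loop hX
  | circle u X v a hX G G₁ hG hG₁ =>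
    rw [map_smul, graphAlgebraHom_graph, graphAlgebraHom_graph]
    rw [Drawing.image_eq_smul (G := G) (G' := G₁) (u := u) (v := v)
      (s := [⟨a, .cap⟩] ++ shift (a + 1) X ++ [⟨a, .cup⟩])
      (t := shift a X) (by simpa using hG) (by simpa using hG₁) 0
      ((d : K) ^ 2 - 1)]
    · rw [zpow_zero, Units.val_one, one_mul]
    · simp only [excess_append, excess_shift]
      simp [excess, Piece.excess]
    · exact fun m l x hx hs _ => hx.fullCable_circle hX hs.1
  | univalent u v a G hG =>
    rw [map_zero, graphAlgebraHom_graph]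
    obtain ⟨k, l, hu, hs, hv⟩ := exists_runs_of_word hG
    rw [Drawing.image, Drawing.toTLₗ_context hG hu hs, toTLₗ_fullCable_congr (g := 0) hu
      fun x hx => by rw [hx.fullCable_univalent hs, act_zero]]
    simp

/-! ### Descent to the quotient algebra and uniqueness. -/

/-- A non-unital homomorphism that respects a relation descends to the quotient. -/
theorem exists_nonUnitalAlgHom_ringQuot {A B : Type*} [Ring A] [Algebra K A] [Ring B] [Algebra K B]
    {r : A → A → Prop} (f : A →ₙₐ[K] B) (hf : ∀ x y, r x y → f x = f y) :
    ∃ g : RingQuot r →ₙₐ[K] B, ∀ x, g (RingQuot.mkAlgHom K r x) = f x := by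
  have h₁ : ∀ x y, RingQuot.Rel r x y → f x = f y := by
    intro x y h
    induction h with
    | of h => exact hf _ _ h
    | add_left _ ih => rw [map_add, map_add, ih]
    | mul_left _ ih => rw [map_mul, map_mul, ih]
    | mul_right _ ih => rw [map_mul, map_mul, ih]
  have h₂ : ∀ x y, RingQuot.mkAlgHom K r x = RingQuot.mkAlgHom K r y → f x = f y := by
    intro x y h
    -- Equal classes are linked by the equivalence relation generated by `RingQuot.Rel`, whose
    -- closure rules use only sums and products and are therefore respected without preservation of
    -- the unit.
    have h : RingQuot.mkRingHom r x = RingQuot.mkRingHom r y := by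
      rwa [← RingQuot.mkAlgHom_coe K]
    simp only [RingQuot.mkRingHom_def, RingHom.coe_mk, MonoidHom.coe_mk, OneHom.coe_mk,
      RingQuot.mk.injEq] at h
    replace h := Quot.eqvGen_exact h
    clear * - h h₁
    induction h with
    | rel x y h => exact h₁ x y h
    | refl => rfl
    | symm _ _ _ ih => exact ih.symm
    | trans _ _ _ _ _ ih₁ ih₂ => exact ih₁.trans ih₂
  have hs := RingQuot.mkAlgHom_surjective K r
  have h₃ : ∀ x, f (Function.surjInv hs (RingQuot.mkAlgHom K r x)) = f x :=
    fun x => h₂ _ _ (Function.surjInv_eq hs _)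
  refine ⟨{ toFun := fun q => f (Function.surjInv hs q)
            map_smul' := ?_, map_zero' := ?_, map_add' := ?_, map_mul' := ?_ }, h₃⟩
  · intro c q
    obtain ⟨x, rfl⟩ := hs q
    rw [← map_smul, h₃, h₃, map_smul]
    rfl
  · rw [← map_zero (RingQuot.mkAlgHom K r), h₃, map_zero]
  · intro p q
    obtain ⟨x, rfl⟩ := hs p
    obtain ⟨y, rfl⟩ := hs q
    rw [← map_add, h₃, h₃, h₃, map_add]
  · intro p q
    obtain ⟨x, rfl⟩ := hs p
    obtain ⟨y, rfl⟩ := hs q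
    rw [← map_mul, h₃, h₃, h₃, map_mul]

theorem chromaticAlgebra_hom_ext {n : ℕ} {Q : K} {B : Type*} [Ring B] [Algebra K B]
    {f g : ChromaticAlgebra K Q n →ₙₐ[K] B}
    (h : ∀ G : Drawing n, f (chromaticClass Q G) = g (chromaticClass Q G)) : f = g := by
  ext q
  obtain ⟨x, rfl⟩ := RingQuot.mkAlgHom_surjective K (ChromaticRel K Q n) q
  induction x using MonoidAlgebra.induction_on with
  | of p =>
    induction p using Con.induction_on with
    | H G => exact h G
  | add x y hx hy => rw [map_add, map_add, map_add, hx, hy]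
  | smul c x hx => rw [map_smul, map_smul, map_smul, hx]

end

end PlanarPictures

theorem mainTheorem8 {K : Type*} [CommRing K] (d : Kˣ) (n : ℕ) :
    ∃! Φ : PlanarPictures.ChromaticAlgebra K ((d : K) ^ 2) n →ₙₐ[K]
        PlanarPictures.TemperleyLieb K (d : K) (2 * n),
      ∀ (G : PlanarPictures.Drawing n) (E : Finset (ℕ × ℕ)), G.EdgePoints E →
        Φ (PlanarPictures.chromaticClass ((d : K) ^ 2) G) = PlanarPictures.phi d G E := by
  obtain ⟨Φ, hΦ⟩ := PlanarPictures.exists_nonUnitalAlgHom_ringQuot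
    (PlanarPictures.graphAlgebraHom d n) fun _ _ => PlanarPictures.graphAlgebraHom_rel
  refine ⟨Φ, fun G E hE => ?_, fun Ψ hΨ => PlanarPictures.chromaticAlgebra_hom_ext fun G => ?_⟩
  · rw [PlanarPictures.phi_eq_image hE]
    exact (hΦ _).trans (PlanarPictures.graphAlgebraHom_graph G)
  · obtain ⟨E, hE⟩ := G.exists_edgePoints
    rw [hΨ G E hE, PlanarPictures.phi_eq_image hE]
    exact ((hΦ _).trans (PlanarPictures.graphAlgebraHom_graph G)).symm
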